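/- Let $\mathcal P\subset\mathbb R^2$ be a finite set of points and $n\ge 1$. For a point $u$ and $0\le j<n$ let $C_u^j$ be the cone with apex $u$ consisting of the rays with polar angle in $[2j\pi/n,2(j+1)\pi/n)$ (apex excluded). *Yao-Yao graph.* A Yao graph $\mathsf Y_n$ of $\mathcal P$ is a directed graph obtained by selecting, for every $u\in\mathcal P$ and every $j$ with $C_u^j\cap\mathcal P\ne\emptyset$, one point $v\in C_u^j\cap\mathcal P$ nearest to $u$ and adding the edge $\overrightarrow{uv}$. A Yao-Yao graph $\mathsf{YY}_n$ is obtained from it by keeping, for every $u\in\mathcal P$ and every $j$ for which some $v\in C_u^j\cap\mathcal P$ has $\overrightarrow{vu}\in\mathsf Y_n$, one shortest such edge $\overrightarrow{vu}$. Ties are broken arbitrarily in both steps. *Trapezoidal Yao graph.* Let $\theta=\lceil n/8\rceil\cdot 2\pi/n$, let $T=\{(x,y): 0<x<1,\ 0<y<\sin\theta,\ x^2+y^2<1,\ (x-1)^2+y^2<1\}$, and let $T^-$ be the reflection of $T$ through the $x$-axis. The critical arc of $T$ consists of the points of the unit circle with polar angle in $[0,\theta)$, that of $T^-$ of those with polar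 angle in $[-\theta,0]$. For every $u\in\mathcal P$, $0\le j<n$ and $\Gamma\in\{T,T^-\}$, rotate $\Gamma$ by $2j\pi/n$ about the origin, attach the origin to $u$, and scale by a factor $\lambda$ that grows from $0$ until the boundary first hits a point of $\mathcal P\setminus\{u\}$; for every point $v\in\mathcal P$ that is then hit by the critical arc, $\overrightarrow{uv}$ is an edge of $\mathsf{TY}_n$. For a graph $G$ on $\mathcal P$ let $d_G(u,v)$ be the Euclidean length of a shortest $u$–$v$ path in $G$, edge directions being ignored ($\infty$ if there is none). **Lemma.** There are constants $\tau'_k$, depending only on $k$, with $\tau'_k=\sqrt2+O(1/k)$ as $k\to\infty$, such that for every integer $k\ge 42$, every finite $\mathcal P\subset\mathbb R^2$ and every Yao-Yao graph $\mathsf{YY}_{2k}$ of $\mathcal P$, $$d_{\mathsf{YY}_{2k}}(u,v)\le\tau'_k\,|uv|\qquad\text{for every edge }\overrightarrow{uv}\text{ of }\mathsf{TY}_{2k}.$$ Consequently $\mathsf{YY}_{2k}$ spans $\mathsf{TY}_{2k}$: $d_{\mathsf{YY}_{2k}}(u,v)\le\tau'_k\,d_{\mathsf{TY}_{2k}}(u,v)$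 for all $u,v\in\mathcal P$. -/

import Mathlib

open scoped ENNReal

noncomputable section

namespace YaoYao

/-- The cone with apex `u` made of the rays with polar angle in `[γ₁, γ₂)` (angles modulo `2π`; the
apex is not included). The Euclidean plane is identified with `ℂ`. -/
def cone (u : ℂ) (γ₁ γ₂ : ℝ) : Set ℂ :=
  {v | ∃ r φ : ℝ, 0 < r ∧ γ₁ ≤ φ ∧ φ < γ₂ ∧ v = u + (r : ℂ) * Complex.exp ((φ : ℂ) * Complex.I)}

/-- The `j`-th of the `n` cones with apex `u`. -/
def yaoCone (n j : ℕ) (u : ℂ) : Set ℂ :=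
  cone u (2 * j * Real.pi / n) (2 * ((j : ℝ) + 1) * Real.pi / n)

/-- `sel` is a possible outcome of a selection step with `n` cones on `P`: for every `u ∈ P` and every
cone with apex `u` that contains a candidate (a point `v ∈ P` with `cand u v`), exactly one candidate
of the cone is selected, and it is a nearest one. Ties may be broken in any way. -/
structure IsYaoStep (n : ℕ) (P : Finset ℂ) (cand sel : ℂ → ℂ → Prop) : Prop where
  nearest : ∀ u v, sel u v → u ∈ P ∧ v ∈ P ∧ cand u v ∧
    ∃ j < n, v ∈ yaoCone n j u ∧
      ∀ w ∈ P, w ∈ yaoCone n j u → cand u w → dist u v ≤ dist u w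
  existsUnique : ∀ u ∈ P, ∀ j < n, (∃ v ∈ P, v ∈ yaoCone n j u ∧ cand u v) →
    ∃! v, v ∈ yaoCone n j u ∧ sel u v

/-- `Y` is a (directed) Yao graph of `P` with `n` cones. -/
def IsYaoGraph (n : ℕ) (P : Finset ℂ) (Y : ℂ → ℂ → Prop) : Prop :=
  IsYaoStep n P (fun _ _ => True) Y

/-- `E` is a (directed) Yao-Yao graph obtained from the Yao graph `Y` by the reverse Yao step: in each
cone of each `u`, one shortest edge of `Y` among those that enter `u` from that cone is kept. -/
def IsYaoYaoGraph (n : ℕ) (P : Finset ℂ) (Y E : ℂ → ℂ → Prop) : Prop :=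
  IsYaoStep n P (fun u v => Y v u) (fun u v => E v u)

/-- The (open) curved trapezoid, with bottom side from `o = 0` to `p = 1`. -/
def trapezoid (θ : ℝ) : Set ℂ :=
  {z | 0 < z.re ∧ z.re < 1 ∧ 0 < z.im ∧ z.im < Real.sin θ ∧ ‖z‖ < 1 ∧ ‖z - 1‖ < 1}

/-- The points of the unit circle with polar angle in `S`. -/
def unitArc (S : Set ℝ) : Set ℂ :=
  (fun φ : ℝ => Complex.exp ((φ : ℂ) * Complex.I)) '' S

/-- Reflection through the `x`-axis. -/
def reflect (S : Set ℂ) : Set ℂ := (starRingEnd ℂ) '' S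

/-- The copy `u + lam • (S rotated counterclockwise by γ)`. -/
def place (u : ℂ) (lam γ : ℝ) (S : Set ℂ) : Set ℂ :=
  (fun z => u + (lam : ℂ) * (Complex.exp ((γ : ℂ) * Complex.I) * z)) '' S

/-- The shape `Γ`, rotated by `γ`, attached to `u` and grown from size `0`, meets no point of `P`
other than `u` before size `lam`, and at size `lam` the part `A` of its boundary hits `v`. -/
def GrowthHits (P : Finset ℂ) (u : ℂ) (γ : ℝ) (Γ A : Set ℂ) (v : ℂ) : Prop :=
  ∃ lam : ℝ, 0 < lam ∧ v ∈ place u lam γ A ∧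
    ∀ μ : ℝ, 0 < μ → μ < lam → ∀ w ∈ P, w ∈ closure (place u μ γ Γ) → w = u

/-- The angle `θ = ⌈n/8⌉ · 2π/n`. -/
def tyAngle (n : ℕ) : ℝ := (⌈(n : ℝ) / 8⌉₊ : ℝ) * (2 * Real.pi / n)

/-- Directed edges of the trapezoidal Yao graph with parameter `n`. The critical arc of the trapezoid
is the arc of polar angles `0` to `θ`, that of the reflected trapezoid the arc of polar angles `-θ` to
`0`. As cones are half-open, the endpoint of polar angle `θ`, which belongs to the cone next to
the sector spanned by the arc, is not counted. If several points are hit at once, all those on the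
critical arc are selected. -/
def TYEdge (n : ℕ) (P : Finset ℂ) (u v : ℂ) : Prop :=
  u ∈ P ∧ v ∈ P ∧ ∃ j < n,
    GrowthHits P u (2 * j * Real.pi / n) (trapezoid (tyAngle n))
      (unitArc (Set.Ico 0 (tyAngle n))) v ∨
    GrowthHits P u (2 * j * Real.pi / n) (reflect (trapezoid (tyAngle n)))
      (unitArc (Set.Icc (-tyAngle n) 0)) v

/-- Total Euclidean length of a walk. -/
def walkLength {G : SimpleGraph ℂ} : {u v : ℂ} → G.Walk u v → ℝ
  | _, _, SimpleGraph.Walk.nil => 0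
  | _, _, @SimpleGraph.Walk.cons _ _ u w _ _ p => dist u w + walkLength p

/-- Length of a shortest `u`-`v` path in `G` (`⊤` if there is none). -/
def graphDist (G : SimpleGraph ℂ) (u v : ℂ) : ℝ≥0∞ :=
  ⨅ p : G.Walk u v, ENNReal.ofReal (walkLength p)

end YaoYao

end

/-!
Let `L = dist u v` for an edge `uv` of the trapezoidal graph, and let `α` be the aperture of a cone.
No point lies inside the trapezoid of size `L` attached to `u`. The claim is proved by induction on
`L`, with a stretch factor `A` satisfying `1 ≤ A * (1 - 13.2 * α)`.

The two Yao steps from `u` towards `v` give a point `v'` in the cone of `v`, with `dist u v' ≤ L`,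
and an edge from `v'` to a point `w` of the opposite cone. Because the trapezoid is empty,
`dist u v' = L`. The point `w` avoids the trapezoid as well, so it is either below the bottom side
or within `O(α) * L` of `u`. In the second case it suffices that points at distance less than `L`
are joined with stretch `8.5 * A`. In the first case, one walks from `w` to `u` by always moving to
the nearest point of a trapezoid pointing towards `u`; as such a trapezoid meets only points below
the empty one, this walk is almost straight. The same walk, along the chord of the critical arc,
joins `v'` to `v`. All losses are `O(α) * L`, hence are absorbed by the choice of `A`, and the
resulting stretch is `1 + O(α)`.
-/

noncomputable section

namespace YaoYao

open Real ComplexConjugate Filter Topology Pointwise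

/-! ### Walks of bounded length -/

/-- The points `p` and `q` are joined by a walk of `G` of Euclidean length at most `l`. -/
def WalkWithin (G : SimpleGraph ℂ) (p q : ℂ) (l : ℝ) : Prop :=
  ∃ W : G.Walk p q, walkLength W ≤ l

theorem walkLength_append {G : SimpleGraph ℂ} {p q r : ℂ} (W : G.Walk p q) (W' : G.Walk q r) :
    walkLength (W.append W') = walkLength W + walkLength W' := by
  induction W with
  | nil => simp [walkLength]
  | cons h W ih => simp [walkLength, ih, add_assoc]

theorem walkLength_reverse {G : SimpleGraph ℂ} {p q : ℂ} (W : G.Walk p q) :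
    walkLength W.reverse = walkLength W := by
  induction W with
  | nil => simp [walkLength]
  | cons h W ih =>
    simp [SimpleGraph.Walk.reverse_cons, walkLength_append, walkLength, ih, dist_comm, add_comm]

namespace WalkWithin

variable {G : SimpleGraph ℂ} {p q r : ℂ} {l l' : ℝ}

theorem refl (p : ℂ) (hl : 0 ≤ l) : WalkWithin G p p l := ⟨.nil, by simpa [walkLength] using hl⟩

theorem symm (h : WalkWithin G p q l) : WalkWithin G q p l := by
  obtain ⟨W, hW⟩ := h
  exact ⟨W.reverse, by rwa [walkLength_reverse]⟩

theorem mono (h : WalkWithin G p q l) (hl : l ≤ l') : WalkWithin G p q l' := by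
  obtain ⟨W, hW⟩ := h
  exact ⟨W, hW.trans hl⟩

theorem trans (h : WalkWithin G p q l) (h' : WalkWithin G q r l') : WalkWithin G p r (l + l') := by
  obtain ⟨W, hW⟩ := h
  obtain ⟨W', hW'⟩ := h'
  exact ⟨W.append W', by rw [walkLength_append]; exact add_le_add hW hW'⟩

theorem of_adj (h : G.Adj p q) : WalkWithin G p q (dist p q) :=
  ⟨.cons h .nil, by simp [walkLength]⟩

theorem graphDist_le (h : WalkWithin G p q l) : graphDist G p q ≤ ENNReal.ofReal l := by
  obtain ⟨W, hW⟩ := h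
  exact (iInf_le _ W).trans (ENNReal.ofReal_le_ofReal hW)

theorem of_walk {H : SimpleGraph ℂ} {t : ℝ}
    (h : ∀ p q, H.Adj p q → WalkWithin G p q (t * dist p q)) (W : H.Walk p q) :
    WalkWithin G p q (t * walkLength W) := by
  induction W with
  | nil => exact refl _ (by simp [walkLength])
  | cons hadj W ih => exact ((h _ _ hadj).trans ih).mono (by simp [walkLength, mul_add])

end WalkWithin

theorem graphDist_le_mul_of_forall_adj {G H : SimpleGraph ℂ} {t : ℝ} (ht : 0 < t)
    (h : ∀ p q, H.Adj p q → WalkWithin G p q (t * dist p q)) (p q : ℂ) :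
    graphDist G p q ≤ ENNReal.ofReal t * graphDist H p q := by
  rw [graphDist.eq_def H, ENNReal.mul_iInf_of_ne (by simpa using ht) ENNReal.ofReal_ne_top]
  refine le_iInf fun W => ?_
  rw [← ENNReal.ofReal_mul ht.le]
  exact (WalkWithin.of_walk h W).graphDist_le

theorem finset_strong_induction {ι β : Type*} [Preorder β] (s : Finset ι) (f : ι → β)
    {Q : ι → Prop} (step : ∀ x ∈ s, (∀ y ∈ s, f y < f x → Q y) → Q x) : ∀ x ∈ s, Q x :=
  fun _ hx => (Set.Finite.wellFoundedOn (r := f ⁻¹'o (· < ·)) s.finite_toSet).induction hx step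

/-! ### Polar coordinates and cones -/

/-- The complex number with polar coordinates `r` and `φ`; every `r : ℝ` is allowed, and `r < 0`
gives the point opposite to `polar |r| φ`. -/
def polar (r φ : ℝ) : ℂ := r * Complex.exp (φ * Complex.I)

theorem polar_re (r φ : ℝ) : (polar r φ).re = r * cos φ := by
  simp [polar, Complex.exp_ofReal_mul_I_re]

theorem polar_im (r φ : ℝ) : (polar r φ).im = r * sin φ := by
  simp [polar, Complex.exp_ofReal_mul_I_im]

theorem norm_polar {r : ℝ} (hr : 0 ≤ r) (φ : ℝ) : ‖polar r φ‖ = r := by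
  simp [polar, Complex.norm_exp_ofReal_mul_I, abs_of_nonneg hr]

theorem polar_norm_arg (z : ℂ) : polar ‖z‖ z.arg = z := Complex.norm_mul_exp_arg_mul_I z

theorem polar_mul_polar (r s φ ψ : ℝ) : polar r φ * polar s ψ = polar (r * s) (φ + ψ) := by
  simp only [polar, Complex.ofReal_mul, Complex.ofReal_add, add_mul, Complex.exp_add]
  ring

theorem conj_polar (r φ : ℝ) : conj (polar r φ) = polar r (-φ) := by
  simp [polar, ← Complex.exp_conj]

theorem polar_add_int_mul_two_pi (r φ : ℝ) (l : ℤ) : polar r (φ + l * (2 * π)) = polar r φ := by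
  simp [Complex.ext_iff, polar_re, polar_im]

theorem polar_add_odd_mul_pi (r φ : ℝ) {l : ℤ} (hl : Odd l) :
    polar r (φ + l * π) = -polar r φ := by
  obtain ⟨m, rfl⟩ := hl
  have angle : φ + ((2 * m + 1 : ℤ) : ℝ) * π = φ + π + m * (2 * π) := by push_cast; ring
  rw [angle, polar_add_int_mul_two_pi]
  simp [Complex.ext_iff, polar_re, polar_im]

theorem polar_inj {r r' φ φ' : ℝ} (hr : 0 < r) (hr' : 0 < r') (h : polar r φ = polar r' φ') :
    r = r' ∧ ∃ l : ℤ, φ = φ' + l * (2 * π) := by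
  have radius : r = r' := by rw [← norm_polar hr.le φ, h, norm_polar hr'.le]
  subst radius
  obtain ⟨l, hl⟩ := Complex.exp_eq_exp_iff_exists_int.1
    (mul_left_cancel₀ (Complex.ofReal_ne_zero.2 hr.ne') h)
  exact ⟨rfl, l, by simpa using congrArg Complex.im hl⟩

theorem exists_polar_eq (z : ℂ) : ∃ φ : ℝ, 0 ≤ φ ∧ φ < 2 * π ∧ polar ‖z‖ φ = z := by
  obtain ⟨hnonneg, hlt⟩ := toIcoMod_mem_Ico two_pi_pos 0 z.arg
  refine ⟨_, hnonneg, by simpa using hlt, ?_⟩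
  rw [toIcoMod, zsmul_eq_mul, sub_eq_add_neg, ← neg_mul, ← Int.cast_neg,
    polar_add_int_mul_two_pi, polar_norm_arg]

theorem dist_add_polar (u : ℂ) {r : ℝ} (hr : 0 ≤ r) (φ : ℝ) : dist u (u + polar r φ) = r := by
  rw [dist_self_add_right, norm_polar hr]

theorem mem_cone {u v : ℂ} {γ₁ γ₂ : ℝ} :
    v ∈ cone u γ₁ γ₂ ↔ ∃ r φ : ℝ, 0 < r ∧ γ₁ ≤ φ ∧ φ < γ₂ ∧ v = u + polar r φ :=
  Iff.rfl

theorem mem_cone_opposite {u v : ℂ} {γ₁ γ₂ : ℝ} (h : v ∈ cone u γ₁ γ₂) {l : ℤ} (hl : Odd l) :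
    u ∈ cone v (γ₁ + l * π) (γ₂ + l * π) := by
  obtain ⟨r, φ, hr, hφ, hφ', rfl⟩ := mem_cone.1 h
  refine mem_cone.2 ⟨r, φ + l * π, hr, by gcongr, by gcongr, ?_⟩
  rw [polar_add_odd_mul_pi r φ hl]
  ring

/-- The `j`-th cone of aperture `α` with apex `u`, for an arbitrary integer `j`. -/
def sector (α : ℝ) (j : ℤ) (u : ℂ) : Set ℂ := cone u (j * α) ((j + 1) * α)

theorem yaoCone_eq_sector (n j : ℕ) (u : ℂ) : yaoCone n j u = sector (2 * π / n) j u := by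
  rw [yaoCone, sector, Int.cast_natCast]
  congr 1 <;> ring

theorem mem_sector_opposite {α : ℝ} {k : ℕ} (hk : k * α = π) {j j' l : ℤ} (hl : Odd l)
    (hj : j' = j + l * k) {u v : ℂ} (h : v ∈ sector α j u) : u ∈ sector α j' v := by
  have h' := mem_cone_opposite h hl
  rw [← hk] at h'
  have lower : (j * α + l * (k * α) : ℝ) = j' * α := by rw [hj]; push_cast; ring
  have upper : ((j + 1) * α + l * (k * α) : ℝ) = (j' + 1) * α := by rw [hj]; push_cast; ring
  rwa [lower, upper] at h'

theorem exists_mem_yaoCone {n : ℕ} (hn : 0 < n) {u v : ℂ} (h : u ≠ v) :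
    ∃ j < n, v ∈ yaoCone n j u := by
  have hα : 0 < 2 * π / n := by positivity
  obtain ⟨φ, hφ0, hφ_lt, hφ⟩ := exists_polar_eq (v - u)
  refine ⟨⌊φ / (2 * π / n)⌋₊, ?_, ?_⟩
  · rw [Nat.floor_lt (by positivity), div_lt_iff₀ hα]
    calc φ < 2 * π := hφ_lt
      _ = n * (2 * π / n) := by field_simp
  · rw [yaoCone_eq_sector, sector, mem_cone]
    refine ⟨‖v - u‖, φ, norm_pos_iff.2 (sub_ne_zero.2 h.symm), ?_, ?_, by rw [hφ]; ring⟩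
    · rw [← le_div_iff₀ hα]
      exact_mod_cast Nat.floor_le (by positivity)
    · rw [← div_lt_iff₀ hα]
      exact_mod_cast Nat.lt_floor_add_one _

theorem yaoCone_index_unique {n i j : ℕ} (hi : i < n) (hj : j < n) {u v : ℂ}
    (h : v ∈ yaoCone n i u) (h' : v ∈ yaoCone n j u) : i = j := by
  rw [yaoCone_eq_sector, sector] at h h'
  obtain ⟨r, φ, hr, hφ, hφ', rfl⟩ := mem_cone.1 h
  obtain ⟨r', ψ, hr', hψ, hψ', he⟩ := mem_cone.1 h'
  obtain ⟨-, l, rfl⟩ := polar_inj hr hr' (add_left_cancel he)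
  have hn : (0 : ℝ) < n := by exact_mod_cast (Nat.zero_le i).trans_lt hi
  have hα : 0 < 2 * π / n := by positivity
  have turn : 2 * π = n * (2 * π / n) := by field_simp
  generalize 2 * π / n = α at *
  rw [turn] at hφ hφ'
  have upper : (i : ℤ) < j + 1 + l * n := by
    have : (i : ℝ) < j + 1 + l * n :=
      lt_of_mul_lt_mul_right (by push_cast at *; linarith) hα.le
    exact_mod_cast this
  have lower : (j : ℤ) + l * n < i + 1 := by
    have : (j : ℝ) + l * n < i + 1 :=
      lt_of_mul_lt_mul_right (by push_cast at *; linarith) hα.le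
    exact_mod_cast this
  obtain rfl : l = 0 := by
    have l_lt : l < 1 := lt_of_mul_lt_mul_right (a := (n : ℤ)) (by linarith) (by positivity)
    have lt_l : -1 < l := lt_of_mul_lt_mul_right (a := (n : ℤ)) (by linarith) (by positivity)
    lia
  lia

/-! ### The two Yao steps -/

/-- For any two points `u` and `v` of `P`, the Yao step selects from `u` a nearest point `v'` of the
sector of `v`, and the reverse Yao step keeps an edge that enters `v'` from the opposite sector. -/
def HasYaoYaoSteps (α : ℝ) (P : Finset ℂ) (G : SimpleGraph ℂ) : Prop :=
  ∀ u ∈ P, ∀ v ∈ P, u ≠ v → ∃ j : ℤ, ∃ v' ∈ P, ∃ w ∈ P,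
    v ∈ sector α j u ∧ v' ∈ sector α j u ∧ v' ∈ sector α j w ∧
      dist u v' ≤ dist u v ∧ dist w v' ≤ dist u v' ∧ G.Adj w v'

theorem IsYaoStep.exists_nearest {n j : ℕ} {P : Finset ℂ} {cand sel : ℂ → ℂ → Prop}
    (h : IsYaoStep n P cand sel) {u v : ℂ} (hu : u ∈ P) (hv : v ∈ P) (hj : j < n)
    (hvj : v ∈ yaoCone n j u) (huv : cand u v) :
    ∃ v' ∈ P, v' ∈ yaoCone n j u ∧ cand u v' ∧ sel u v' ∧ dist u v' ≤ dist u v := by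
  obtain ⟨v', ⟨hv'j, hsel⟩, -⟩ := h.existsUnique u hu j hj ⟨v, hv, hvj, huv⟩
  obtain ⟨-, hv', hcand, i, hi, hv'i, hmin⟩ := h.nearest u v' hsel
  obtain rfl := yaoCone_index_unique hi hj hv'i hv'j
  exact ⟨v', hv', hv'i, hcand, hsel, hmin v hv hvj huv⟩

theorem exists_opposite_index {k i : ℕ} (hi : i < 2 * k) :
    ∃ j < 2 * k, ∃ l : ℤ, Odd l ∧ (j : ℤ) = i + l * k := by
  rcases lt_or_ge i k with h | h
  · exact ⟨i + k, by lia, 1, by decide, by push_cast; ring⟩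
  · exact ⟨i - k, by lia, -1, by decide, by push_cast [h]; ring⟩

theorem hasYaoYaoSteps_of_isYaoYaoGraph {k : ℕ} (hk : 0 < k) {P : Finset ℂ} {Y E : ℂ → ℂ → Prop}
    (hY : IsYaoGraph (2 * k) P Y) (hE : IsYaoYaoGraph (2 * k) P Y E) :
    HasYaoYaoSteps (2 * π / (2 * k : ℕ)) P (SimpleGraph.fromRel E) := by
  intro u hu v hv huv
  have half_turn : k * (2 * π / (2 * k : ℕ)) = π := by push_cast; field_simp
  obtain ⟨j, hj, hvj⟩ := exists_mem_yaoCone (n := 2 * k) (by lia) huv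
  obtain ⟨v', hv', hv'j, -, hYuv', hd⟩ := hY.exists_nearest hu hv hj hvj trivial
  obtain ⟨j', hj', l, hl, hjl⟩ := exists_opposite_index hj
  have huj' : u ∈ yaoCone (2 * k) j' v' := by
    rw [yaoCone_eq_sector] at hv'j ⊢
    exact mem_sector_opposite half_turn hl hjl hv'j
  obtain ⟨w, hw, hwj', -, hEwv', hd'⟩ := hE.exists_nearest hv' hu hj' huj' hYuv'
  rw [yaoCone_eq_sector] at hvj hv'j hwj'
  have hv'w : v' ∈ sector (2 * π / (2 * k : ℕ)) j w :=
    mem_sector_opposite half_turn hl.neg (by rw [hjl]; ring) hwj'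
  rw [dist_comm v' w, dist_comm v' u] at hd'
  refine ⟨j, v', hv', w, hw, hvj, hv'j, hv'w, hd, hd', ?_⟩
  obtain ⟨r, φ, hr, -, -, hv'_eq⟩ := mem_cone.1 hv'w
  refine (SimpleGraph.fromRel_adj _ _ _).2 ⟨?_, Or.inl hEwv'⟩
  rw [← dist_pos, hv'_eq, dist_add_polar w hr.le]
  exact hr

/-! ### The angles -/

/-- The angles of the construction: `α` is the aperture of the cones, a fraction of a half turn,
and `θ`, a multiple of `α` close to `π / 4`, is the angle spanned by the critical arc of a
trapezoid. The numerical bounds are those that hold for `2 * k` cones with `42 ≤ k`. -/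
structure ConeAngles (α θ : ℝ) : Prop where
  pos : 0 < α
  le : α ≤ 0.0748
  exists_half_turn : ∃ k : ℕ, k * α = π
  exists_multiple : ∃ N : ℕ, θ = N * α
  pi_div_four_le : π / 4 ≤ θ
  le_pi_div_four_add : θ ≤ π / 4 + 3 / 4 * α

theorem mul_le_sin {x : ℝ} (h0 : 0 ≤ x) (h : x ≤ 0.0748) : 0.999 * x ≤ sin x := by
  obtain rfl | hpos := h0.eq_or_lt
  · simp
  have cube : x ^ 3 ≤ 0.0748 ^ 2 * x := by
    rw [pow_succ]
    gcongr
  linarith [Real.sin_gt_sub_cube hpos]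

theorem le_cos_of_abs_le {x : ℝ} (h : |x| ≤ 0.0748) : 0.997 ≤ cos x := by
  have hsq : x ^ 2 ≤ 0.0748 ^ 2 := sq_le_sq.2 (h.trans (le_abs_self _))
  linarith [Real.one_sub_sq_div_two_le_cos (x := x)]

variable {α θ A : ℝ}

namespace ConeAngles

theorem theta_lt (S : ConeAngles α θ) : θ < 0.86 := by
  linarith [S.le_pi_div_four_add, S.le, Real.pi_lt_d4]

theorem theta_gt (S : ConeAngles α θ) : 0.78 < θ := by
  linarith [S.pi_div_four_le, Real.pi_gt_d4]

theorem theta_pos (S : ConeAngles α θ) : 0 < θ := by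
  linarith [S.theta_gt]

theorem theta_lt_pi_div_two (S : ConeAngles α θ) : θ < π / 2 := by
  linarith [S.theta_lt, Real.pi_gt_d4]

theorem cos_theta_pos (S : ConeAngles α θ) : 0 < cos θ :=
  Real.cos_pos_of_mem_Ioo ⟨by linarith [S.theta_pos, Real.pi_pos], S.theta_lt_pi_div_two⟩

theorem sin_theta_pos (S : ConeAngles α θ) : 0 < sin θ :=
  Real.sin_pos_of_pos_of_lt_pi S.theta_pos (by linarith [S.theta_lt_pi_div_two, Real.pi_pos])

theorem cos_theta_le_sin_theta (S : ConeAngles α θ) : cos θ ≤ sin θ := by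
  rw [← Real.sin_pi_div_two_sub]
  exact Real.sin_le_sin_of_le_of_le_pi_div_two
    (by linarith [S.theta_lt_pi_div_two, Real.pi_pos]) S.theta_lt_pi_div_two.le
    (by linarith [S.pi_div_four_le])

theorem cos_theta_ge (S : ConeAngles α θ) : 0.66585 ≤ cos θ := by
  have hθ : cos (π / 4 + 0.0561) ≤ cos θ :=
    Real.cos_le_cos_of_nonneg_of_le_pi S.theta_pos.le
      (by linarith [Real.pi_gt_d4]) (by linarith [S.le_pi_div_four_add, S.le])
  rw [Real.cos_add, Real.cos_pi_div_four, Real.sin_pi_div_four] at hθ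
  have hcos := Real.one_sub_sq_div_two_le_cos (x := 0.0561)
  have hsin := Real.sin_le (x := 0.0561) (by norm_num)
  have hsqrt : (1.41421 : ℝ) ≤ √2 := Real.le_sqrt_of_sq_le (by norm_num)
  nlinarith

theorem sin_theta_le (S : ConeAngles α θ) : sin θ ≤ 0.7468 := by
  refine abs_le_of_sq_le_sq' ?_ (by norm_num) |>.2
  nlinarith [S.cos_theta_ge, Real.sin_sq_add_cos_sq θ]

theorem sin_alpha_ge (S : ConeAngles α θ) : 0.999 * α ≤ sin α := mul_le_sin S.pos.le S.le

end ConeAngles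

/-! ### Frames -/

/-- Complex conjugation if `σ = true`, and the identity otherwise: it allows to treat the trapezoids
`T` and `T⁻` together. -/
def conjIf (σ : Bool) (z : ℂ) : ℂ := cond σ (conj z) z

/-- Coordinates of `z` in the frame with origin `u` and `x`-axis in the direction of the unit vector
`e`; the frame is negatively oriented if `σ = true`. -/
def frame (u e : ℂ) (σ : Bool) (z : ℂ) : ℂ := conjIf σ ((z - u) * conj e)

/-- The directions of the boundaries of the cones. -/
def IsConeDirection (α : ℝ) (e : ℂ) : Prop := ∃ j : ℤ, e = polar 1 (j * α)

theorem IsConeDirection.norm_eq_one {e : ℂ} (he : IsConeDirection α e) : ‖e‖ = 1 := by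
  obtain ⟨j, rfl⟩ := he
  exact norm_polar zero_le_one _

theorem norm_conjIf (σ : Bool) (z : ℂ) : ‖conjIf σ z‖ = ‖z‖ := by
  cases σ <;> simp [conjIf]

theorem conjIf_polar (σ : Bool) (r φ : ℝ) :
    conjIf σ (polar r φ) = polar r (cond σ (-φ) φ) := by
  cases σ
  · rfl
  · exact conj_polar r φ

theorem IsConeDirection.mul_conjIf {e : ℂ} (he : IsConeDirection α e) (σ : Bool) (l : ℤ) :
    IsConeDirection α (e * conjIf σ (polar 1 (l * α))) := by
  obtain ⟨j, rfl⟩ := he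
  refine ⟨cond σ (j - l) (j + l), ?_⟩
  rw [conjIf_polar, polar_mul_polar, one_mul]
  congr 1
  cases σ <;> simp only [cond_true, cond_false] <;> push_cast <;> ring

theorem IsConeDirection.neg {k : ℕ} (hk : k * α = π) {e : ℂ} (he : IsConeDirection α e) :
    IsConeDirection α (-e) := by
  obtain ⟨j, rfl⟩ := he
  refine ⟨j + k, ?_⟩
  rw [← polar_add_odd_mul_pi 1 _ odd_one, ← hk]
  congr 1
  push_cast
  ring

theorem frame_self (u e : ℂ) (σ : Bool) : frame u e σ u = 0 := by
  cases σ <;> simp [frame, conjIf]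

theorem frame_eq_sub (u e : ℂ) (σ : Bool) (y z : ℂ) :
    frame y e σ z = frame u e σ z - frame u e σ y := by
  cases σ <;> simp [frame, conjIf] <;> ring

theorem frame_not (u e : ℂ) (σ : Bool) (z : ℂ) : frame u e (!σ) z = conj (frame u e σ z) := by
  cases σ <;> simp [frame, conjIf]

theorem frame_neg (u e : ℂ) (σ : Bool) (z : ℂ) : frame u (-e) σ z = -frame u e σ z := by
  cases σ <;> simp [frame, conjIf]

theorem frame_neg_not (u e : ℂ) (σ : Bool) (y z : ℂ) :
    frame y (-e) (!σ) z = -conj (frame u e σ z - frame u e σ y) := by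
  rw [frame_neg, frame_not, frame_eq_sub u]

theorem frame_mul_conjIf (u e c : ℂ) (σ : Bool) (z : ℂ) :
    frame u (e * conjIf σ c) σ z = frame u e σ z * conj c := by
  cases σ <;> simp [frame, conjIf] <;> ring

theorem norm_frame {e : ℂ} (he : ‖e‖ = 1) (u : ℂ) (σ : Bool) (z : ℂ) :
    ‖frame u e σ z‖ = dist u z := by
  rw [frame, norm_conjIf, norm_mul, RCLike.norm_conj, he, mul_one, dist_comm, dist_eq_norm]

theorem norm_frame_sub {e : ℂ} (he : ‖e‖ = 1) (u : ℂ) (σ : Bool) (y z : ℂ) :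
    ‖frame u e σ z - frame u e σ y‖ = dist y z := by
  rw [← frame_eq_sub, norm_frame he]

theorem frame_injective {e : ℂ} (he : ‖e‖ = 1) (u : ℂ) (σ : Bool) :
    Function.Injective (frame u e σ) := fun y z h => by
  rw [← dist_eq_zero, ← norm_frame_sub he u σ, h, sub_self, norm_zero]

/-! ### Trapezoids -/

/-- The trapezoid of size `L` with bottom side from `0` to `L`, as in `trapezoid`, but including the
points of the open bottom side. -/
def trapezoidWithBase (θ L : ℝ) : Set ℂ :=
  {ζ | 0 ≤ ζ.im ∧ ζ.im < L * sin θ ∧ ‖ζ‖ < L ∧ ‖ζ - L‖ < L}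

theorem sq_norm_eq (ζ : ℂ) : ‖ζ‖ ^ 2 = ζ.re ^ 2 + ζ.im ^ 2 := by
  rw [Complex.sq_norm, Complex.normSq_apply]
  ring

theorem norm_lt_iff_sq {ζ : ℂ} {L : ℝ} (hL : 0 ≤ L) : ‖ζ‖ < L ↔ ζ.re ^ 2 + ζ.im ^ 2 < L ^ 2 := by
  rw [← sq_norm_eq, sq_lt_sq₀ (norm_nonneg ζ) hL]

theorem norm_le_iff_sq {ζ : ℂ} {L : ℝ} (hL : 0 ≤ L) : ‖ζ‖ ≤ L ↔ ζ.re ^ 2 + ζ.im ^ 2 ≤ L ^ 2 := by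
  rw [← sq_norm_eq, sq_le_sq₀ (norm_nonneg ζ) hL]

theorem norm_sub_ofReal_lt_iff {ζ : ℂ} {L : ℝ} (hL : 0 ≤ L) :
    ‖ζ - L‖ < L ↔ ζ.re ^ 2 + ζ.im ^ 2 < 2 * L * ζ.re := by
  rw [norm_lt_iff_sq hL, Complex.sub_re, Complex.ofReal_re, Complex.sub_im, Complex.ofReal_im,
    sub_zero, sub_sq]
  constructor <;> intro h <;> linarith

theorem mem_trapezoidWithBase_iff {L : ℝ} {ζ : ℂ} (hL : 0 ≤ L) : ζ ∈ trapezoidWithBase θ L ↔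
    0 ≤ ζ.im ∧ ζ.im < L * sin θ ∧ ζ.re ^ 2 + ζ.im ^ 2 < L ^ 2 ∧
      ζ.re ^ 2 + ζ.im ^ 2 < 2 * L * ζ.re := by
  rw [← norm_lt_iff_sq hL, ← norm_sub_ofReal_lt_iff hL]
  rfl

theorem re_pos_of_mem_trapezoidWithBase {L : ℝ} {ζ : ℂ} (hL : 0 ≤ L)
    (h : ζ ∈ trapezoidWithBase θ L) : 0 < ζ.re := by
  have disc := ((mem_trapezoidWithBase_iff hL).1 h).2.2.2
  exact pos_of_mul_pos_right (lt_of_le_of_lt (by positivity) disc) (by positivity)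

theorem trapezoidWithBase_mono (hθ : 0 ≤ sin θ) {L L' : ℝ} (hL : 0 ≤ L) (h : L ≤ L') :
    trapezoidWithBase θ L ⊆ trapezoidWithBase θ L' := fun ζ hζ => by
  have hre := re_pos_of_mem_trapezoidWithBase hL hζ
  obtain ⟨him, hheight, hdisc, hdisc'⟩ := (mem_trapezoidWithBase_iff hL).1 hζ
  exact (mem_trapezoidWithBase_iff (hL.trans h)).2
    ⟨him, hheight.trans_le (by gcongr), hdisc.trans_le (by gcongr), hdisc'.trans_le (by gcongr)⟩

theorem re_mul_sin_sub_im_mul_cos (ζ : ℂ) (θ : ℝ) :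
    ζ.re * sin θ - ζ.im * cos θ = ‖ζ‖ * sin (θ - ζ.arg) := by
  rw [Real.sin_sub, ← Complex.norm_mul_cos_arg ζ, ← Complex.norm_mul_sin_arg ζ]
  ring

theorem arg_le_of_im_mul_cos_le {ζ : ℂ} (hθ : 0 < θ) (h : ζ.im * cos θ ≤ ζ.re * sin θ) :
    ζ.arg ≤ θ := by
  by_contra! hlt
  have hζ : 0 < ‖ζ‖ := norm_pos_iff.2 fun h0 => by simp [h0] at hlt; linarith
  have hsin : sin (θ - ζ.arg) < 0 :=
    Real.sin_neg_of_neg_of_neg_pi_lt (by linarith) (by linarith [Complex.arg_le_pi ζ])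
  linarith [re_mul_sin_sub_im_mul_cos ζ θ, mul_neg_of_pos_of_neg hζ hsin]

theorem arg_lt_of_im_mul_cos_lt {ζ : ℂ} (hθ : 0 < θ) (h : ζ.im * cos θ < ζ.re * sin θ) :
    ζ.arg < θ := by
  refine (arg_le_of_im_mul_cos_le hθ h.le).lt_of_ne fun heq => ?_
  have hsub := re_mul_sin_sub_im_mul_cos ζ θ
  rw [heq, sub_self, Real.sin_zero, mul_zero] at hsub
  linarith

/-- The bound to be proved if `v` is hit by the critical arc of an empty trapezoid attached to `u`.
The point of the arc at angle `θ` counts only for the reflected trapezoid, that is for `σ = true`.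
The `min` in the bound, which vanishes with the angle, keeps walks along a line cheap. -/
def SpansArcHits (α θ A : ℝ) (P : Finset ℂ) (G : SimpleGraph ℂ) (u v : ℂ) : Prop :=
  ∀ (e : ℂ) (σ : Bool) (φ : ℝ), IsConeDirection α e → 0 ≤ φ → φ ≤ θ → (φ < θ ∨ σ = true) →
    frame u e σ v = polar (dist u v) φ →
    (∀ z ∈ P, frame u e σ z ∉ trapezoidWithBase θ (dist u v)) →
    WalkWithin G u v (A * dist u v + 3 * A * dist u v * min (sin φ) (sin α))

theorem SpansArcHits.walkWithin {P : Finset ℂ} {G : SimpleGraph ℂ} {u v e : ℂ} {σ : Bool}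
    (h : SpansArcHits α θ A P G u v) (hθ : 0 < θ) (he : IsConeDirection α e)
    (him : 0 ≤ (frame u e σ v).im)
    (hs : (frame u e σ v).im * cos θ ≤ (frame u e σ v).re * sin θ)
    (hs' : (frame u e σ v).im * cos θ < (frame u e σ v).re * sin θ ∨ σ = true)
    (hT : ∀ z ∈ P, frame u e σ z ∉ trapezoidWithBase θ (dist u v)) :
    WalkWithin G u v (A * dist u v + 3 * A * min (frame u e σ v).im (dist u v * sin α)) := by
  have hn := norm_frame he.norm_eq_one u σ v
  refine (h e σ (frame u e σ v).arg he (Complex.arg_nonneg_iff.2 him)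
    (arg_le_of_im_mul_cos_le hθ hs) (hs'.imp_left (arg_lt_of_im_mul_cos_lt hθ))
    (by rw [← hn, polar_norm_arg]) hT).mono (le_of_eq ?_)
  rw [← Complex.norm_mul_sin_arg (frame u e σ v), hn, ← mul_min_of_nonneg _ _ dist_nonneg]
  ring

/-! ### Points at small distance -/

/-- The wedge of half-aperture `θ` around the positive `x`-axis. -/
def wedge (θ : ℝ) : Set ℂ := {ζ | |ζ.im| * cos θ ≤ ζ.re * sin θ}

theorem conjIf_mem_wedge_iff (σ : Bool) (ζ : ℂ) : conjIf σ ζ ∈ wedge θ ↔ ζ ∈ wedge θ := by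
  cases σ <;> simp [conjIf, wedge]

theorem polar_mem_wedge {r x : ℝ} (hr : 0 ≤ r) (hx : |x| ≤ θ) (hθ : θ ≤ π / 2) :
    polar r x ∈ wedge θ := by
  have hsub : 0 ≤ sin (θ - |x|) :=
    Real.sin_nonneg_of_nonneg_of_le_pi (by linarith) (by linarith [abs_nonneg x, Real.pi_pos])
  rw [Real.sin_sub, Real.cos_abs, ← Real.abs_sin_eq_sin_abs_of_abs_le_pi
    (by linarith [Real.pi_pos])] at hsub
  simp only [wedge, Set.mem_ofPred_eq, polar_re, polar_im, abs_mul, abs_of_nonneg hr, mul_assoc]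
  exact mul_le_mul_of_nonneg_left (by linarith) hr

theorem mem_wedge_of_mul_polar_mem (hcos : 0 ≤ cos θ) (hsin : cos θ ≤ sin θ) {L : ℝ} (hL : 0 ≤ L)
    {ζ : ℂ} (h : ζ * polar 1 θ ∈ trapezoidWithBase θ L) : ζ ∈ wedge θ := by
  have hre := re_pos_of_mem_trapezoidWithBase hL h
  have him := h.1
  have hζ : ζ = ζ * polar 1 θ * polar 1 (-θ) := by
    rw [mul_assoc, polar_mul_polar]
    simp [polar]
  generalize ζ * polar 1 θ = ξ at hre him hζ
  subst hζ
  simp only [wedge, Set.mem_ofPred_eq, Complex.mul_re, Complex.mul_im, polar_re, polar_im,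
    Real.cos_neg, Real.sin_neg]
  have hsq : cos θ ^ 2 ≤ sin θ ^ 2 := by gcongr
  have hre_term : 0 ≤ ξ.re * (sin θ * cos θ) :=
    mul_nonneg hre.le (mul_nonneg (hcos.trans hsin) hcos)
  have him_term : ξ.im * cos θ ^ 2 ≤ ξ.im * sin θ ^ 2 := by gcongr
  have him_nonneg : 0 ≤ ξ.im * sin θ ^ 2 := by positivity
  rw [← abs_of_nonneg hcos, ← abs_mul, abs_of_nonneg hcos, abs_le]
  constructor <;> nlinarith

theorem ConeAngles.norm_sub_norm_le (S : ConeAngles α θ) {ζ : ℂ} (h : ζ ∈ wedge θ) :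
    ‖ζ - ‖ζ‖‖ ≤ 0.8175 * ‖ζ‖ := by
  have hcos := S.cos_theta_pos
  have hre : 0 ≤ ζ.re :=
    nonneg_of_mul_nonneg_left ((mul_nonneg (abs_nonneg _) hcos.le).trans h) S.sin_theta_pos
  have hre_ge : ‖ζ‖ * cos θ ≤ ζ.re := by
    refine abs_le_of_sq_le_sq' ?_ hre |>.2
    have hsq : (|ζ.im| * cos θ) ^ 2 ≤ (ζ.re * sin θ) ^ 2 :=
      pow_le_pow_left₀ (by positivity) h 2
    rw [mul_pow, mul_pow, sq_abs, Real.sin_sq] at hsq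
    rw [mul_pow, sq_norm_eq]
    linarith
  have hre_ge' : ‖ζ‖ * 0.66585 ≤ ζ.re := le_trans (by gcongr; exact S.cos_theta_ge) hre_ge
  rw [norm_le_iff_sq (by positivity), Complex.sub_re, Complex.ofReal_re, Complex.sub_im,
    Complex.ofReal_im]
  nlinarith [sq_norm_eq ζ, norm_nonneg ζ]

theorem norm_sub_le_of_directions {ζ ξ : ℂ} {a b : ℝ} (hζ : ‖ζ - ‖ζ‖‖ ≤ a * ‖ζ‖)
    (hξ : ‖ξ - ‖ξ‖‖ ≤ b * ‖ξ‖) (h : ‖ζ‖ ≤ ‖ξ‖) (h0 : 0 < ‖ξ‖) :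
    ‖ζ - ξ‖ ≤ ‖ξ‖ - ‖ζ‖ + (a + b) * ‖ζ‖ := by
  set r := ‖ζ‖
  set d := ‖ξ‖
  have hrd : r / d ≤ 1 := (div_le_one h0).2 h
  have decomposition :
      ζ - ξ = (ζ - r) - ((r / d : ℝ) : ℂ) * (ξ - d) - ((1 - r / d : ℝ) : ℂ) * ξ := by
    have : (d : ℂ) ≠ 0 := by exact_mod_cast h0.ne'
    push_cast
    field_simp
    ring
  calc ‖ζ - ξ‖ ≤ ‖ζ - r‖ + ‖((r / d : ℝ) : ℂ) * (ξ - d)‖ + ‖((1 - r / d : ℝ) : ℂ) * ξ‖ := by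
        rw [decomposition]
        exact (norm_sub_le _ _).trans (add_le_add_left (norm_sub_le _ _) _)
    _ = ‖ζ - r‖ + r / d * ‖ξ - d‖ + (1 - r / d) * d := by
        rw [norm_mul, norm_mul, Complex.norm_real, Complex.norm_real,
          Real.norm_of_nonneg (by positivity), Real.norm_of_nonneg (by linarith)]
    _ ≤ a * r + r / d * (b * d) + (1 - r / d) * d := by gcongr
    _ = d - r + (a + b) * r := by field_simp; ring

theorem norm_polar_sub_le {r : ℝ} (hr : 0 ≤ r) (x : ℝ) : ‖polar r x - r‖ ≤ |x| * r := by
  have factor : polar r x - r = r * (Complex.exp (Complex.I * x) - 1) := by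
    rw [polar, mul_comm Complex.I]
    ring
  rw [factor, norm_mul, Complex.norm_real, Real.norm_of_nonneg hr, mul_comm]
  gcongr
  exact Real.norm_exp_I_mul_ofReal_sub_one_le

theorem exists_nearest_coneDirection (hα : 0 < α) (p q : ℂ) :
    ∃ e, IsConeDirection α e ∧ ∃ x : ℝ, |x| ≤ α / 2 ∧ frame p e false q = polar (dist p q) x := by
  set φ := (q - p).arg
  refine ⟨_, ⟨round (φ / α), rfl⟩, φ - round (φ / α) * α, ?_, ?_⟩
  · have hround : φ - round (φ / α) * α = (φ / α - round (φ / α)) * α := by field_simp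
    rw [hround, abs_mul, abs_of_pos hα]
    linarith [mul_le_mul_of_nonneg_right (abs_sub_round (φ / α)) hα.le]
  · rw [frame, conjIf, cond_false, conj_polar, ← polar_norm_arg (q - p), polar_mul_polar, mul_one,
      dist_comm, dist_eq_norm, ← sub_eq_add_neg]

theorem exists_frame_im_nonpos (p e z : ℂ) :
    ∃ σ, (frame p e σ z).im ≤ 0 ∧ ((frame p e σ z).im < 0 ∨ σ = true) := by
  rcases lt_or_ge (frame p e false z).im 0 with h | h
  · exact ⟨false, h.le, Or.inl h⟩
  · refine ⟨true, ?_, Or.inr rfl⟩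
    rw [← Bool.not_false, frame_not]
    simpa using h

theorem IsConeDirection.exists_frame_eq_mul_polar (S : ConeAngles α θ) {e : ℂ}
    (he : IsConeDirection α e) (p : ℂ) (σ : Bool) :
    ∃ e', IsConeDirection α e' ∧ ∀ y, frame p e' σ y = frame p e σ y * polar 1 θ := by
  obtain ⟨N, hN⟩ := S.exists_multiple
  refine ⟨_, he.mul_conjIf σ (-N), fun y => ?_⟩
  rw [frame_mul_conjIf, conj_polar, hN]
  congr 2
  push_cast
  ring

theorem walkWithin_of_nearest_in_wedge (S : ConeAngles α θ) (hA : 0 ≤ A) {P : Finset ℂ}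
    {G : SimpleGraph ℂ} {p z e : ℂ} (he : IsConeDirection α e)
    (hzW : frame p e false z ∈ wedge θ)
    (hmin : ∀ y ∈ P, y ≠ p → frame p e false y ∈ wedge θ → dist p z ≤ dist p y)
    (hE : SpansArcHits α θ A P G p z) : WalkWithin G p z (A * (1 + 3 * α) * dist p z) := by
  have hcos := S.cos_theta_pos
  have wedge_iff (σ : Bool) (y : ℂ) : frame p e false y ∈ wedge θ ↔ frame p e σ y ∈ wedge θ := by
    rw [frame, frame, conjIf_mem_wedge_iff, conjIf_mem_wedge_iff]
  obtain ⟨σ, hle, hlt⟩ := exists_frame_im_nonpos p e z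
  obtain ⟨e', he', rotated⟩ := he.exists_frame_eq_mul_polar S p σ
  have hempty (y : ℂ) (hy : y ∈ P) : frame p e' σ y ∉ trapezoidWithBase θ (dist p z) := by
    intro hT
    have hy_ne : y ≠ p := by
      rintro rfl
      simpa [frame_self] using re_pos_of_mem_trapezoidWithBase dist_nonneg hT
    have hyW : frame p e false y ∈ wedge θ := (wedge_iff σ y).2 <|
      mem_wedge_of_mul_polar_mem hcos.le S.cos_theta_le_sin_theta dist_nonneg (rotated y ▸ hT)
    have hdist : dist p y < dist p z := by
      rw [← norm_frame he'.norm_eq_one p σ y]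
      exact hT.2.2.1
    exact (hmin y hy hy_ne hyW).not_gt hdist
  have hzW' : |(frame p e σ z).im| * cos θ ≤ (frame p e σ z).re * sin θ := (wedge_iff σ z).1 hzW
  rw [abs_of_nonpos hle] at hzW'
  have him : (frame p e' σ z).im = (frame p e σ z).re * sin θ + (frame p e σ z).im * cos θ := by
    simp [rotated, Complex.mul_im, polar_re, polar_im]
  have hslope : (frame p e' σ z).re * sin θ - (frame p e' σ z).im * cos θ
      = -(frame p e σ z).im := by
    simp only [rotated, Complex.mul_re, Complex.mul_im, polar_re, polar_im]
    linear_combination (-(frame p e σ z).im) * Real.sin_sq_add_cos_sq θ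
  refine (hE.walkWithin S.theta_pos he' (by linarith) (by linarith)
    (hlt.imp_left fun h => by linarith) hempty).mono ?_
  have hmin_le : min (frame p e' σ z).im (dist p z * sin α) ≤ dist p z * α :=
    (min_le_right _ _).trans (by gcongr; exact Real.sin_le S.pos.le)
  linarith [mul_le_mul_of_nonneg_left hmin_le hA]

theorem exists_walk_towards (S : ConeAngles α θ) (hA : 0 ≤ A) {P : Finset ℂ} {G : SimpleGraph ℂ}
    {p q : ℂ} (hq : q ∈ P) (hpq : p ≠ q)
    (hE : ∀ z ∈ P, dist p z ≤ dist p q → SpansArcHits α θ A P G p z) :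
    ∃ z ∈ P, 0 < dist p z ∧ WalkWithin G p z (A * (1 + 3 * α) * dist p z) ∧
      dist z q ≤ dist p q - dist p z + (0.8175 + α / 2) * dist p z := by
  classical
  obtain ⟨e, he, x, hx, hxq⟩ := exists_nearest_coneDirection S.pos p q
  have hqW : frame p e false q ∈ wedge θ := hxq ▸ polar_mem_wedge dist_nonneg
    (by linarith [S.theta_gt, S.le]) S.theta_lt_pi_div_two.le
  obtain ⟨z, hz, hmin⟩ := Finset.exists_min_image
    (P.filter fun z => z ≠ p ∧ frame p e false z ∈ wedge θ) (dist p)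
    ⟨q, by simp [hq, hpq.symm, hqW]⟩
  simp only [Finset.mem_filter] at hz hmin
  obtain ⟨hzP, hzp, hzW⟩ := hz
  have hzq : dist p z ≤ dist p q := hmin q ⟨hq, hpq.symm, hqW⟩
  refine ⟨z, hzP, dist_pos.2 hzp.symm, walkWithin_of_nearest_in_wedge S hA he hzW
    (fun y hy hyp hyW => hmin y ⟨hy, hyp, hyW⟩) (hE z hzP hzq), ?_⟩
  have hnz := norm_frame he.norm_eq_one p false z
  have hnq := norm_frame he.norm_eq_one p false q
  have hqdir : ‖frame p e false q - ‖frame p e false q‖‖ ≤ α / 2 * ‖frame p e false q‖ := by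
    rw [hnq, hxq]
    exact (norm_polar_sub_le dist_nonneg x).trans (by gcongr)
  have hstep := norm_sub_le_of_directions (S.norm_sub_norm_le hzW) hqdir (by rwa [hnz, hnq])
    (by rw [hnq]; exact dist_pos.2 hpq)
  rwa [hnz, hnq, norm_frame_sub he.norm_eq_one, dist_comm q z] at hstep

theorem walkWithin_of_dist_lt (S : ConeAngles α θ) (hA : 0 ≤ A) {P : Finset ℂ} {G : SimpleGraph ℂ}
    {L : ℝ} (hE : ∀ p ∈ P, ∀ q ∈ P, dist p q < L → SpansArcHits α θ A P G p q) {p q : ℂ}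
    (hp : p ∈ P) (hq : q ∈ P) (hL : dist p q < L) : WalkWithin G p q (8.5 * A * dist p q) := by
  suffices h : ∀ x ∈ P ×ˢ P, dist x.1 x.2 < L → WalkWithin G x.1 x.2 (8.5 * A * dist x.1 x.2) from
    h (p, q) (Finset.mk_mem_product hp hq) hL
  refine finset_strong_induction _ (fun x => dist x.1 x.2) ?_
  rintro ⟨p, q⟩ hpq ih hL
  obtain ⟨hp, hq⟩ := Finset.mem_product.1 hpq
  rcases eq_or_ne p q with rfl | hne
  · exact WalkWithin.refl _ (by simp)
  obtain ⟨z, hz, hz0, hpz, hzq⟩ := exists_walk_towards S hA hq hne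
    fun z hz hd => hE p hp z hz (hd.trans_lt hL)
  dsimp only at hL ih ⊢
  have hα := S.le
  have hcloser : dist z q < dist p q := by nlinarith
  refine (hpz.trans (ih (z, q) (Finset.mk_mem_product hz hq) hcloser (hcloser.trans hL))).mono ?_
  have hcost := mul_le_mul_of_nonneg_left hzq hA
  -- `1 + 3 * α ≤ 8.5 * (1 - 0.8175 - α / 2)`
  nlinarith [mul_nonneg hA hz0.le]

/-! ### Points below an empty trapezoid -/

theorem norm_le_re_add_of_abs_re_le_im {ζ : ℂ} (h : |ζ.re| ≤ ζ.im) :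
    8.5 * ‖ζ‖ ≤ ζ.re + 13.03 * ζ.im := by
  have him : 0 ≤ ζ.im := (abs_nonneg _).trans h
  have hsq : ζ.re ^ 2 ≤ ζ.im ^ 2 := sq_le_sq.2 (h.trans (le_abs_self _))
  have hnorm : ‖ζ‖ ≤ 1.4143 * ζ.im := (norm_le_iff_sq (by positivity)).2 (by nlinarith)
  linarith [neg_le_of_abs_le h]

/-- One step of a walk costs at most `A` times the decrease of the potential `re - 13.03 * im`: if
the step is steep by `walkWithin_of_dist_lt`, and otherwise because it is an arc hit. -/
theorem walkWithin_of_nearest (S : ConeAngles α θ) (hA : 0 ≤ A) {P : Finset ℂ} {G : SimpleGraph ℂ}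
    {L : ℝ} (hE : ∀ p ∈ P, ∀ q ∈ P, dist p q < L → SpansArcHits α θ A P G p q)
    {y z e : ℂ} {σ : Bool} (he : IsConeDirection α e) (hy : y ∈ P) (hz : z ∈ P)
    (hL : dist y z < L) (hre : 0 ≤ (frame y e σ z).re) (him : 0 ≤ (frame y e σ z).im)
    (hT : ∀ x ∈ P, frame y e σ x ∉ trapezoidWithBase θ (dist y z)) :
    WalkWithin G y z (A * ((frame y e σ z).re + 13.03 * (frame y e σ z).im)) := by
  have hnorm := norm_frame he.norm_eq_one y σ z
  set δ := frame y e σ z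
  rcases le_or_gt δ.re δ.im with hsteep | hflat
  · refine (walkWithin_of_dist_lt S hA hE hy hz hL).mono ?_
    rw [← hnorm, mul_comm 8.5 A, mul_assoc]
    gcongr
    exact norm_le_re_add_of_abs_re_le_im (by rwa [abs_of_nonneg hre])
  · have hslope : δ.im * cos θ < δ.re * sin θ :=
      mul_lt_mul_of_pos_of_nonneg' hflat S.cos_theta_le_sin_theta S.cos_theta_pos hre
    refine ((hE y hy z hz hL).walkWithin S.theta_pos he him hslope.le (Or.inl hslope) hT).mono ?_
    have hnorm_le : ‖δ‖ ≤ δ.re + δ.im := by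
      rw [norm_le_iff_sq (by positivity)]
      nlinarith
    rw [← hnorm]
    calc A * ‖δ‖ + 3 * A * min δ.im (‖δ‖ * sin α)
        ≤ A * (δ.re + δ.im) + 3 * A * δ.im := by
          gcongr
          exact min_le_left _ _
      _ ≤ A * (δ.re + 13.03 * δ.im) := by linarith [mul_nonneg hA him]

/-- The part of the disc of radius `R` below the `x`-axis in which one walks towards the origin. -/
def lowRegion (R : ℝ) : Set ℂ := {ζ | ζ.im ≤ 0 ∧ ζ.im ≤ ζ.re ∧ ‖ζ‖ ≤ R}

theorem neg_conj_sub_mem_trapezoidWithBase_iff {η ζ : ℂ} {r : ℝ} (hr : 0 ≤ r) :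
    -conj (ζ - η) ∈ trapezoidWithBase θ r ↔
      η.im ≤ ζ.im ∧ ζ.im - η.im < r * sin θ ∧ (η.re - ζ.re) ^ 2 + (ζ.im - η.im) ^ 2 < r ^ 2 ∧
        (η.re - ζ.re) ^ 2 + (ζ.im - η.im) ^ 2 < 2 * r * (η.re - ζ.re) := by
  rw [mem_trapezoidWithBase_iff hr]
  simp [neg_add_eq_sub]

theorem mem_trapezoidWithBase_of_mem_towards_origin (hθ : 0 ≤ sin θ) {η ζ : ℂ} {R : ℝ}
    (hη_re : 0 < η.re) (hη_im : η.im ≤ 0) (hR : ‖η‖ ≤ R)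
    (hζ : -conj (ζ - η) ∈ trapezoidWithBase θ ‖η‖) (hpos : 0 < ζ.im) :
    ζ ∈ trapezoidWithBase θ R := by
  obtain ⟨-, hheight, hdisc, hdisc'⟩ :=
    (neg_conj_sub_mem_trapezoidWithBase_iff (norm_nonneg η)).1 hζ
  have hnorm := sq_norm_eq η
  have hre_le : η.re ≤ ‖η‖ := Complex.re_le_norm η
  have hcross : 0 ≤ ζ.im * -η.im := mul_nonneg hpos.le (by linarith)
  have hchord : ζ.re ^ 2 + ζ.im ^ 2 < 2 * ‖η‖ * ζ.re := by
    have h : ζ.re ^ 2 + ζ.im ^ 2 < 2 * η.re * ζ.re := by nlinarith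
    have hζ_re : 0 < ζ.re := pos_of_mul_pos_right (lt_of_le_of_lt (by positivity) h) (by positivity)
    exact h.trans_le (by gcongr)
  refine trapezoidWithBase_mono hθ (norm_nonneg η) hR
    ((mem_trapezoidWithBase_iff (norm_nonneg η)).2 ⟨hpos.le, by linarith, ?_, hchord⟩)
  have hζ_re : 0 < ζ.re :=
    pos_of_mul_pos_right (lt_of_le_of_lt (by positivity) hchord) (by positivity)
  have hre_sq : ζ.re ^ 2 ≤ (ζ.re + (‖η‖ - η.re)) ^ 2 := by
    gcongr
    linarith
  nlinarith

theorem mem_lowRegion_of_mem_towards_origin {η ζ : ℂ} (hη_im : η.im ≤ 0) (hη : -η.im < η.re)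
    (hζ : -conj (ζ - η) ∈ trapezoidWithBase θ ‖η‖) (hneg : ζ.im ≤ 0) : ζ ∈ lowRegion ‖η‖ := by
  obtain ⟨hbottom, -, hdisc, hdisc'⟩ :=
    (neg_conj_sub_mem_trapezoidWithBase_iff (norm_nonneg η)).1 hζ
  have hnorm := sq_norm_eq η
  have hlt : 0 < η.re - ζ.re :=
    pos_of_mul_pos_right (lt_of_le_of_lt (by positivity) hdisc') (by positivity)
  have hdiag : ζ.im ≤ ζ.re := by
    by_contra! h
    have hsq : (η.re - ζ.im) ^ 2 ≤ (η.re - ζ.re) ^ 2 := by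
      gcongr
      linarith
    nlinarith [mul_nonneg (neg_nonneg.2 hneg) (by linarith : 0 ≤ η.re + η.im - ζ.im)]
  refine ⟨hneg, hdiag, (norm_le_iff_sq (norm_nonneg η)).2 ?_⟩
  have him_sq : ζ.im ^ 2 ≤ η.im ^ 2 := by nlinarith
  have hre_sq : ζ.re ^ 2 ≤ η.re ^ 2 := sq_le_sq' (by linarith) (by linarith)
  linarith

theorem exists_nearest_mem_trapezoidWithBase (hθ : 0 ≤ sin θ) {P : Finset ℂ} {u y e : ℂ}
    (hu : u ∈ P) (he : ‖e‖ = 1) (σ : Bool) :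
    ∃ z ∈ P, (frame y e σ z ∈ trapezoidWithBase θ (dist y u) ∨ z = u) ∧ dist y z ≤ dist y u ∧
      ∀ x ∈ P, frame y e σ x ∉ trapezoidWithBase θ (dist y z) := by
  classical
  obtain ⟨z, hz, hmin⟩ := Finset.exists_min_image
    (P.filter fun z => frame y e σ z ∈ trapezoidWithBase θ (dist y u) ∨ z = u) (dist y)
    ⟨u, by simp [hu]⟩
  simp only [Finset.mem_filter] at hz hmin
  have hyz : dist y z ≤ dist y u := hmin u ⟨hu, Or.inr rfl⟩
  refine ⟨z, hz.1, hz.2, hyz, fun x hx hT => ?_⟩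
  have hcloser : dist y x < dist y z := norm_frame he y σ x ▸ hT.2.2.1
  exact hcloser.not_ge (hmin x ⟨hx, Or.inl (trapezoidWithBase_mono hθ dist_nonneg hyz hT)⟩)

section Below

variable {P : Finset ℂ} {G : SimpleGraph ℂ} {L R : ℝ} {u e : ℂ} {σ : Bool}

theorem exists_step_below (S : ConeAngles α θ) (hA : 0 ≤ A)
    (hE : ∀ p ∈ P, ∀ q ∈ P, dist p q < L → SpansArcHits α θ A P G p q)
    (hu : u ∈ P) (he : IsConeDirection α e)
    (hD : ∀ z ∈ P, 0 < (frame u e σ z).im → frame u e σ z ∉ trapezoidWithBase θ R)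
    {y : ℂ} (hy : y ∈ P) (hyu : y ≠ u) (hlow : frame u e σ y ∈ lowRegion R) (hL : dist u y < L)
    (hflat : -(frame u e σ y).im < (frame u e σ y).re) :
    ∃ z ∈ P, (z = u ∨ frame u e σ z ∈ lowRegion (dist u y) ∧
        (frame u e σ z).re < (frame u e σ y).re) ∧
      WalkWithin G y z (A * ((frame u e σ y).re - (frame u e σ z).re
        + 13.03 * ((frame u e σ z).im - (frame u e σ y).im))) := by
  obtain ⟨k, hk⟩ := S.exists_half_turn
  obtain ⟨him, -, hR⟩ := hlow
  have hsθ := S.sin_theta_pos.le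
  have he' := he.neg hk
  have hnorm := norm_frame he.norm_eq_one u σ y
  obtain ⟨z, hzP, hz, hyz, hempty⟩ :=
    exists_nearest_mem_trapezoidWithBase hsθ hu he'.norm_eq_one (y := y) (!σ)
  rw [dist_comm y u] at hz hyz
  set F := frame u e σ
  set F' := frame y (-e) (!σ)
  have hF' (z : ℂ) : F' z = -conj (F z - F y) := frame_neg_not u e σ y z
  have hF're (z : ℂ) : (F' z).re = (F y).re - (F z).re := by simp [hF']
  have hF'im (z : ℂ) : (F' z).im = (F z).im - (F y).im := by
    simp [hF', neg_add_eq_sub]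
  have hFu : F u = 0 := frame_self u e σ
  have hF'z : 0 ≤ (F' z).re ∧ 0 ≤ (F' z).im := by
    rcases hz with hT | rfl
    · exact ⟨(re_pos_of_mem_trapezoidWithBase dist_nonneg hT).le, hT.1⟩
    · rw [hF're, hF'im, hFu, Complex.zero_re, Complex.zero_im]
      constructor <;> linarith
  refine ⟨z, hzP, hz.symm.imp_right fun hT => ?_, ?_⟩
  · have hlt := re_pos_of_mem_trapezoidWithBase dist_nonneg hT
    rw [hF're, sub_pos] at hlt
    rw [hF', ← hnorm] at hT
    have hz_im : (F z).im ≤ 0 := not_lt.1 fun hpos => hD z hzP hpos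
      (mem_trapezoidWithBase_of_mem_towards_origin hsθ (by linarith) him hR hT hpos)
    exact ⟨hnorm ▸ mem_lowRegion_of_mem_towards_origin him hflat hT hz_im, hlt⟩
  · have hstep := walkWithin_of_nearest S hA hE he' hy hzP (hyz.trans_lt hL) hF'z.1 hF'z.2 hempty
    rwa [hF're, hF'im] at hstep

theorem walkWithin_of_mem_lowRegion (S : ConeAngles α θ) (hA : 0 ≤ A)
    (hE : ∀ p ∈ P, ∀ q ∈ P, dist p q < L → SpansArcHits α θ A P G p q)
    (hu : u ∈ P) (he : IsConeDirection α e)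
    (hD : ∀ z ∈ P, 0 < (frame u e σ z).im → frame u e σ z ∉ trapezoidWithBase θ R) :
    ∀ y ∈ P, frame u e σ y ∈ lowRegion R → dist u y < L →
      WalkWithin G y u (A * ((frame u e σ y).re - 13.03 * (frame u e σ y).im)) := by
  refine finset_strong_induction P (fun y => (frame u e σ y).re) fun y hy ih hlow hL => ?_
  have hnorm := norm_frame he.norm_eq_one u σ
  rcases le_or_gt (frame u e σ y).re (-(frame u e σ y).im) with hsteep | hflat
  · refine (walkWithin_of_dist_lt S hA hE hy hu (by rwa [dist_comm])).mono ?_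
    have h := norm_le_re_add_of_abs_re_le_im (ζ := conj (frame u e σ y))
      (abs_le.2 ⟨by simpa using hlow.2.1, by simpa using hsteep⟩)
    rw [RCLike.norm_conj, hnorm, Complex.conj_re, Complex.conj_im] at h
    rw [dist_comm, mul_comm 8.5 A, mul_assoc]
    gcongr
    linarith
  rcases eq_or_ne y u with rfl | hyu
  · exact WalkWithin.refl _ (by simp [frame_self])
  obtain ⟨z, hz, rfl | ⟨hz_low, hlt⟩, hyz⟩ :=
    exists_step_below S hA hE hu he hD hy hyu hlow hL hflat
  · refine hyz.mono (le_of_eq ?_)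
    rw [frame_self, Complex.zero_re, Complex.zero_im]
    ring
  · have hz_dist : dist u z ≤ dist u y := hnorm z ▸ hz_low.2.2
    have hz_low' : frame u e σ z ∈ lowRegion R :=
      ⟨hz_low.1, hz_low.2.1, hz_low.2.2.trans (hnorm y ▸ hlow.2.2)⟩
    exact (hyz.trans (ih z hz hlt hz_low' (hz_dist.trans_lt hL))).mono (by linarith)

end Below

/-! ### Two points on the critical arc -/

theorem polar_sub_polar (r m γ : ℝ) :
    polar r (m - γ) - polar r (m + γ) = polar (2 * r * sin γ) (m - π / 2) := by
  apply Complex.ext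
  · rw [Complex.sub_re, polar_re, polar_re, polar_re, Real.cos_sub_pi_div_two, Real.cos_sub,
      Real.cos_add]
    ring
  · rw [Complex.sub_im, polar_im, polar_im, polar_im, Real.sin_sub_pi_div_two, Real.sin_sub,
      Real.sin_add]
    ring

theorem norm_polar_sub_polar_lt {L r φ ω : ℝ} (hL : 0 ≤ L) (hr : 0 < r)
    (h : r < 2 * L * cos (φ - ω)) : ‖polar L φ - polar r ω‖ < L := by
  rw [norm_lt_iff_sq hL, Complex.sub_re, Complex.sub_im, polar_re, polar_re, polar_im, polar_im]
  have law_of_cosines : (L * cos φ - r * cos ω) ^ 2 + (L * sin φ - r * sin ω) ^ 2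
      = L ^ 2 + r * (r - 2 * L * cos (φ - ω)) := by
    rw [Real.cos_sub]
    linear_combination L ^ 2 * Real.sin_sq_add_cos_sq φ + r ^ 2 * Real.sin_sq_add_cos_sq ω
  linarith [mul_neg_of_pos_of_neg hr (sub_neg.2 h)]

section Arc

variable {L m γ r ω : ℝ}

theorem mul_sin_le_mul_sin_add (hL : 0 ≤ L) (hr : 0 ≤ r) (hrγ : r ≤ 2 * L * sin γ) (hγ : 0 ≤ γ)
    (hγα : γ ≤ α / 2) (hα : α < 1) (hγm : γ ≤ m) (hm : m + γ < 1)
    (hφ : m + γ ≤ α ∨ α ≤ m - γ) (hω : -1 ≤ ω) (hω' : ω ≤ m - α + π / 2) :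
    r * sin ω ≤ L * sin (m + γ) := by
  have hpi := Real.pi_gt_d4
  have hpi' := Real.pi_lt_d4
  rcases hφ with hφ | hφ
  · have hsin_ω : sin ω ≤ cos γ := by
      rw [← Real.sin_pi_div_two_sub]
      exact Real.sin_le_sin_of_le_of_le_pi_div_two (by linarith) (by linarith) (by linarith)
    have hcos : 0 ≤ cos γ := Real.cos_nonneg_of_mem_Icc ⟨by linarith, by linarith⟩
    calc r * sin ω ≤ r * cos γ := by gcongr
      _ ≤ 2 * L * sin γ * cos γ := by gcongr
      _ = L * sin (2 * γ) := by rw [Real.sin_two_mul]; ring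
      _ ≤ L * sin (m + γ) := by
        gcongr 1
        exact Real.sin_le_sin_of_le_of_le_pi_div_two (by linarith) (by linarith) (by linarith)
  · have hsin : 2 / π * (m + γ) ≤ sin (m + γ) := Real.mul_le_sin (by linarith) (by linarith)
    have hle : 2 * γ ≤ 2 / π * (m + γ) := by
      rw [div_mul_eq_mul_div, le_div_iff₀ Real.pi_pos]
      nlinarith
    calc r * sin ω ≤ r * 1 := by gcongr; exact Real.sin_le_one ω
      _ ≤ L * (2 * sin γ) := by linarith
      _ ≤ L * sin (m + γ) := by
        gcongr
        linarith [Real.sin_le hγ]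

theorem mul_sin_add_lt_add_mul_sin (S : ConeAngles α θ) (hL : 0 < L) (hr : 0 < r)
    (hrα : r ≤ L * α) (hγ : 0 ≤ γ) (hγα : γ ≤ α / 2) (hγm : γ ≤ m) (hm : m + γ ≤ θ)
    (hω : m - 2 * α < ω) (hω' : ω < m - α + π / 2) :
    L * sin (m + γ) < L * sin θ + r * sin ω := by
  have hα := S.pos
  have hα' := S.le
  have hθ := S.theta_lt
  have hpi := Real.pi_gt_d4
  rcases le_or_gt (2 * α) m with hm' | hm'
  · have hsin : sin (m + γ) ≤ sin θ :=
      Real.sin_le_sin_of_le_of_le_pi_div_two (by linarith) (by linarith) hm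
    have hsin_ω : 0 < sin ω := Real.sin_pos_of_pos_of_lt_pi (by linarith) (by linarith)
    linarith [mul_le_mul_of_nonneg_left hsin hL.le, mul_pos hr hsin_ω]
  · have hsin : sin (m + γ) ≤ 0.2 := (Real.sin_le (by linarith)).trans (by linarith)
    have hsin_θ : 0.66585 ≤ sin θ := S.cos_theta_ge.trans S.cos_theta_le_sin_theta
    have hr_ω : -r ≤ r * sin ω := by nlinarith [Real.neg_one_le_sin ω]
    nlinarith

/-- The triangle formed by the upper end `polar L (m + γ)` of the chord and the points seen from it
less than a right angle away from the lower end lies in the trapezoid. -/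
theorem polar_sub_polar_mem_trapezoidWithBase (S : ConeAngles α θ) (hL : 0 < L) (hr : 0 < r)
    (hrγ : r ≤ 2 * L * sin γ) (hγ : 0 ≤ γ) (hγα : γ ≤ α / 2) (hγm : γ ≤ m) (hm : m + γ ≤ θ)
    (hφ : m + γ ≤ α ∨ α ≤ m - γ) (hω : m - 2 * α < ω) (hω' : ω < m - α + π / 2) :
    polar L (m + γ) - polar r ω ∈ trapezoidWithBase θ L := by
  have hα := S.pos
  have hα' := S.le
  have hθ := S.theta_lt
  have hpi := Real.pi_gt_d4
  have hrα : r ≤ L * α := by nlinarith [Real.sin_le hγ]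
  have hcos_lt : sin γ < cos (m + γ - ω) := by
    rw [← Real.cos_pi_div_two_sub, ← Real.cos_abs (m + γ - ω)]
    exact Real.cos_lt_cos_of_nonneg_of_le_pi (abs_nonneg _) (by linarith)
      (abs_lt.2 ⟨by linarith, by linarith⟩)
  have hnorm : ‖polar L (m + γ) - polar r ω‖ < L :=
    norm_polar_sub_polar_lt hL.le hr (hrγ.trans_lt (by gcongr))
  have hsq := (norm_lt_iff_sq hL.le).1 hnorm
  have hre : 0.55 * L ≤ (polar L (m + γ) - polar r ω).re := by
    have hcos : cos θ ≤ cos (m + γ) :=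
      Real.cos_le_cos_of_nonneg_of_le_pi (by linarith) (by linarith) hm
    rw [Complex.sub_re, polar_re, polar_re]
    nlinarith [S.cos_theta_ge, Real.cos_le_one ω]
  refine (mem_trapezoidWithBase_iff hL.le).2 ⟨?_, ?_, hsq, hsq.trans (by nlinarith)⟩
  · rw [Complex.sub_im, polar_im, polar_im, sub_nonneg]
    exact mul_sin_le_mul_sin_add hL.le hr.le hrγ hγ hγα (by linarith) hγm (by linarith) hφ
      (by linarith) hω'.le
  · rw [Complex.sub_im, polar_im, polar_im, sub_lt_iff_lt_add]
    exact mul_sin_add_lt_add_mul_sin S hL hr hrα hγ hγα hγm hm hω hω'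

theorem exists_int_mul_mem_Icc (hα : 0 < α) (x : ℝ) :
    ∃ l : ℤ, α ≤ x - l * α ∧ x - l * α ≤ 2 * α := by
  refine ⟨⌊x / α⌋ - 1, ?_, ?_⟩
  · have hfloor := (le_div_iff₀ hα).1 (Int.floor_le (x / α))
    push_cast
    linarith
  · have hfloor := (div_lt_iff₀ hα).1 (Int.lt_floor_add_one (x / α))
    push_cast
    linarith

theorem frame_eq_sub_polar (u e : ℂ) (σ : Bool) (ν : ℝ) (b z : ℂ) :
    frame u e σ z = frame u e σ b
      - polar ‖frame b (e * conjIf σ (polar 1 ν)) (!σ) z‖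
          (ν + π - (frame b (e * conjIf σ (polar 1 ν)) (!σ) z).arg) := by
  have hframe : frame b (e * conjIf σ (polar 1 ν)) (!σ) z
      = conj ((frame u e σ z - frame u e σ b) * polar 1 (-ν)) := by
    rw [frame_not, frame_mul_conjIf, frame_eq_sub u e σ b z, conj_polar]
  generalize frame b (e * conjIf σ (polar 1 ν)) (!σ) z = ξ at hframe ⊢
  have hrot : conj ξ * polar 1 ν = frame u e σ z - frame u e σ b := by
    rw [hframe, Complex.conj_conj, mul_assoc, polar_mul_polar, one_mul, neg_add_cancel]
    simp [polar]
  have hξ : conj ξ * polar 1 ν = -polar ‖ξ‖ (ν + π - ξ.arg) := by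
    have hangle : ν + π - ξ.arg = -ξ.arg + ν + (1 : ℤ) * π := by push_cast; ring
    conv_lhs => rw [← polar_norm_arg ξ]
    rw [conj_polar, polar_mul_polar, mul_one, hangle, polar_add_odd_mul_pi _ _ odd_one, neg_neg]
  rw [sub_eq_add_neg, ← hξ, hrot, add_sub_cancel]

variable {P : Finset ℂ} {G : SimpleGraph ℂ} {u e : ℂ} {σ : Bool}

theorem notMem_trapezoidWithBase_of_arc (S : ConeAngles α θ)
    (hT : ∀ z ∈ P, frame u e σ z ∉ trapezoidWithBase θ L) (hL : 0 < L) (hγ : 0 ≤ γ)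
    (hγα : γ ≤ α / 2) (hγm : γ ≤ m) (hm : m + γ ≤ θ) (hφ : m + γ ≤ α ∨ α ≤ m - γ)
    {b : ℂ} (hFb : frame u e σ b = polar L (m + γ)) {ν : ℝ} (hν : α ≤ m - π / 2 - ν)
    (hν' : m - π / 2 - ν ≤ 2 * α) {z : ℂ} (hz : z ∈ P)
    (hpos : 0 < (frame b (e * conjIf σ (polar 1 ν)) (!σ) z).im) :
    frame b (e * conjIf σ (polar 1 ν)) (!σ) z ∉ trapezoidWithBase θ (2 * L * sin γ) := by
  intro hzT
  have hF := frame_eq_sub_polar u e σ ν b z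
  rw [hFb] at hF
  set ξ := frame b (e * conjIf σ (polar 1 ν)) (!σ) z
  have hsin_γ : 0 ≤ sin γ :=
    Real.sin_nonneg_of_nonneg_of_le_pi hγ (by linarith [S.le, Real.pi_gt_d4])
  have hre : 0 < ξ.re := re_pos_of_mem_trapezoidWithBase (by positivity) hzT
  have harg : 0 < ξ.arg := (Complex.arg_nonneg_iff.2 hpos.le).lt_of_ne' fun h0 =>
    hpos.ne' (Complex.arg_eq_zero_iff.1 h0).2
  have harg' : ξ.arg < π / 2 := Complex.arg_lt_pi_div_two_iff.2 (Or.inl hre)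
  have hξ : 0 < ‖ξ‖ := norm_pos_iff.2 fun h0 => by simp [h0] at hpos
  exact hT z hz (hF ▸ polar_sub_polar_mem_trapezoidWithBase S hL hξ hzT.2.2.1.le hγ hγα hγm hm hφ
    (by linarith) (by linarith))

theorem walkWithin_of_arc (S : ConeAngles α θ) (hA : 0 ≤ A)
    (hE : ∀ p ∈ P, ∀ q ∈ P, dist p q < L → SpansArcHits α θ A P G p q)
    (he : IsConeDirection α e) (hT : ∀ z ∈ P, frame u e σ z ∉ trapezoidWithBase θ L) (hL : 0 < L)
    (hγ : 0 ≤ γ) (hγα : γ ≤ α / 2) (hγm : γ ≤ m) (hm : m + γ ≤ θ) (hφ : m + γ ≤ α ∨ α ≤ m - γ)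
    {a b : ℂ} (ha : a ∈ P) (hb : b ∈ P) (hFa : frame u e σ a = polar L (m - γ))
    (hFb : frame u e σ b = polar L (m + γ)) :
    WalkWithin G a b (A * (1 + 26.06 * α) * (2 * L * γ)) := by
  have hα := S.pos
  have hα' := S.le
  have hpi := Real.pi_gt_d4
  have hsin_γ : 0 ≤ sin γ := Real.sin_nonneg_of_nonneg_of_le_pi hγ (by linarith)
  have hsin_γ_le := Real.sin_le hγ
  obtain ⟨l, hl, hl'⟩ := exists_int_mul_mem_Icc hα (m - π / 2)
  have hempty (z : ℂ) (hz : z ∈ P) :=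
    notMem_trapezoidWithBase_of_arc S hT hL hγ hγα hγm hm hφ hFb hl hl' hz
  have he' : IsConeDirection α (e * conjIf σ (polar 1 (l * α))) := he.mul_conjIf σ l
  have hframe_a : frame b (e * conjIf σ (polar 1 (l * α))) (!σ) a
      = polar (2 * L * sin γ) (-(m - π / 2 - l * α)) := by
    rw [frame_not, frame_mul_conjIf, frame_eq_sub u e σ b, conj_polar, hFa, hFb, polar_sub_polar,
      polar_mul_polar, mul_one, conj_polar, ← sub_eq_add_neg]
  generalize e * conjIf σ (polar 1 (l * α)) = e' at hempty he' hframe_a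
  generalize m - π / 2 - l * α = δ at hl hl' hframe_a
  have hR : 0 ≤ 2 * L * sin γ := by positivity
  have hdist : dist b a = 2 * L * sin γ := by
    rw [← norm_frame he'.norm_eq_one b (!σ) a, hframe_a, norm_polar hR]
  have hsin : 0 ≤ sin δ := Real.sin_nonneg_of_nonneg_of_le_pi (by linarith) (by linarith)
  have hsin' : sin δ ≤ 2 * α := (Real.sin_le (by linarith)).trans hl'
  have hcos : 0 ≤ cos δ := Real.cos_nonneg_of_mem_Icc ⟨by linarith, by linarith⟩
  have hlow : frame b e' (!σ) a ∈ lowRegion (2 * L * sin γ) := by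
    rw [hframe_a]
    refine ⟨?_, ?_, (norm_polar hR _).le⟩ <;>
      simp only [polar_re, polar_im, Real.sin_neg, Real.cos_neg] <;> nlinarith
  refine (walkWithin_of_mem_lowRegion S hA hE hb he' hempty a ha hlow (by nlinarith)).mono ?_
  rw [hframe_a, polar_re, polar_im, Real.cos_neg, Real.sin_neg]
  have hfactor : cos δ + 13.03 * sin δ ≤ 1 + 26.06 * α := by linarith [Real.cos_le_one δ]
  calc A * (2 * L * sin γ * cos δ - 13.03 * (2 * L * sin γ * -sin δ))
      = A * (cos δ + 13.03 * sin δ) * (2 * L * sin γ) := by ring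
    _ ≤ A * (1 + 26.06 * α) * (2 * L * γ) :=
      mul_le_mul (mul_le_mul_of_nonneg_left hfactor hA) (by gcongr) hR (by positivity)

end Arc

/-! ### The induction step -/

/-- A closed interval between consecutive multiples of `α` inside `[0, θ]`: the polar angles that
one Yao cone occupies in a frame along a cone direction. -/
def IsAngleCell (α θ : ℝ) (I : Set ℝ) : Prop :=
  ∃ m : ℕ, (m + 1) * α ≤ θ ∧ I = Set.Icc (m * α) ((m + 1) * α)

namespace IsAngleCell

variable {I : Set ℝ} {φ φ' : ℝ}

theorem nonneg (hI : IsAngleCell α θ I) (hα : 0 ≤ α) (hφ : φ ∈ I) : 0 ≤ φ := by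
  obtain ⟨m, -, rfl⟩ := hI
  exact le_trans (by positivity) hφ.1

theorem le (hI : IsAngleCell α θ I) (hφ : φ ∈ I) : φ ≤ θ := by
  obtain ⟨m, hm, rfl⟩ := hI
  exact hφ.2.trans hm

theorem abs_sub_le (hI : IsAngleCell α θ I) (hφ : φ ∈ I) (hφ' : φ' ∈ I) : |φ - φ'| ≤ α := by
  obtain ⟨m, -, rfl⟩ := hI
  rw [abs_le]
  constructor <;> linarith [hφ.1, hφ.2, hφ'.1, hφ'.2]

theorem sin_nonneg (hI : IsAngleCell α θ I) (S : ConeAngles α θ) (hφ : φ ∈ I) : 0 ≤ sin φ :=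
  Real.sin_nonneg_of_nonneg_of_le_pi (hI.nonneg S.pos.le hφ)
    (by linarith [hI.le hφ, S.theta_lt_pi_div_two, Real.pi_pos])

theorem subset_Iic_or_subset_Ici (hI : IsAngleCell α θ I) (hα : 0 ≤ α) :
    I ⊆ Set.Iic α ∨ I ⊆ Set.Ici α := by
  obtain ⟨m, -, rfl⟩ := hI
  rcases m with _ | m
  · exact Or.inl fun φ hφ => by simpa using hφ.2
  · refine Or.inr fun φ hφ => le_trans ?_ hφ.1
    push_cast
    nlinarith [mul_nonneg m.cast_nonneg hα]

end IsAngleCell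

theorem frame_add_polar (u : ℂ) (β : ℝ) (σ : Bool) (r ψ : ℝ) :
    frame u (polar 1 β) σ (u + polar r ψ) = polar r (cond σ (β - ψ) (ψ - β)) := by
  rw [frame, add_sub_cancel_left, conj_polar, polar_mul_polar, mul_one, conjIf_polar]
  cases σ <;> simp [sub_eq_add_neg]

theorem IsConeDirection.exists_frame_eq_polar {e : ℂ} (he : IsConeDirection α e) (σ : Bool)
    (j : ℤ) : ∃ i : ℤ, ∀ w, ∀ z ∈ sector α j w, ∃ η, frame w e σ z = polar (dist w z) η ∧
      i * α ≤ η ∧ η ≤ (i + 1) * α ∧ (i * α < η ∨ σ = false) ∧ (η < (i + 1) * α ∨ σ = true) := by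
  obtain ⟨b, rfl⟩ := he
  refine ⟨cond σ (b - j - 1) (j - b), fun w z hz => ?_⟩
  obtain ⟨r, ψ, hr, hψ, hψ', rfl⟩ := mem_cone.1 hz
  rw [frame_add_polar, dist_add_polar w hr.le]
  cases σ
  · refine ⟨_, rfl, ?_, ?_, Or.inr rfl, Or.inl ?_⟩ <;> push_cast [cond_false] <;> linarith
  · refine ⟨_, rfl, ?_, ?_, Or.inl ?_, Or.inr rfl⟩ <;> push_cast [cond_true] <;> linarith

theorem exists_isAngleCell (S : ConeAngles α θ) {u v e : ℂ} {σ : Bool} {φ : ℝ} {j : ℤ}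
    (he : IsConeDirection α e) (hv : v ∈ sector α j u) (huv : u ≠ v)
    (hF : frame u e σ v = polar (dist u v) φ) (hφ : 0 ≤ φ) (hφθ : φ ≤ θ)
    (hφ' : 0 < φ ∨ σ = false) (hφθ' : φ < θ ∨ σ = true) :
    ∃ I, IsAngleCell α θ I ∧ φ ∈ I ∧
      ∀ w, ∀ z ∈ sector α j w, ∃ η ∈ I, frame w e σ z = polar (dist w z) η := by
  have hα := S.pos
  obtain ⟨k, hk⟩ := S.exists_half_turn
  obtain ⟨N, hN⟩ := S.exists_multiple
  obtain ⟨i, hi⟩ := he.exists_frame_eq_polar σ j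
  obtain ⟨ω, hω, hlow, hupp, hlow', hupp'⟩ := hi u v hv
  obtain ⟨-, l, rfl⟩ := polar_inj (dist_pos.2 huv) (dist_pos.2 huv) (hF.symm.trans hω)
  have hturn (x : ℝ) : x * α + l * (2 * π) = (x + 2 * k * l) * α := by
    rw [← hk]; ring
  have hpos : 0 < (i + 2 * k * l + 1 : ℝ) * α := by
    rw [add_right_comm, ← hturn]
    rcases hφ' with h | h
    · linarith
    · linarith [hupp'.resolve_right (by simp [h])]
  have hlt : (i + 2 * k * l : ℝ) * α < N * α := by
    rw [← hturn, ← hN]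
    rcases hφθ' with h | h
    · linarith
    · linarith [hlow'.resolve_right (by simp [h])]
  obtain ⟨m, hm⟩ : ∃ m : ℕ, i + 2 * k * l = (m : ℤ) := by
    refine Int.eq_ofNat_of_zero_le (Int.lt_add_one_iff.1 ?_)
    exact_mod_cast pos_of_mul_pos_left hpos hα.le
  have hm' : (i + 2 * k * l : ℝ) = m := by exact_mod_cast hm
  have hmN : m + 1 ≤ N := by
    rw [hm'] at hlt
    exact_mod_cast lt_of_mul_lt_mul_right hlt hα.le
  refine ⟨_, ⟨m, ?_, rfl⟩, ?_, fun w z hz => ?_⟩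
  · rw [hN]
    gcongr
    exact_mod_cast hmN
  · rw [← hm', add_right_comm, ← hturn, ← hturn]
    constructor <;> linarith
  · obtain ⟨η, hη, hη_low, hη_upp, -, -⟩ := hi w z hz
    refine ⟨η + l * (2 * π), ?_, by rw [hη, polar_add_int_mul_two_pi]⟩
    rw [← hm', add_right_comm, ← hturn, ← hturn]
    constructor <;> linarith

section CriticalArc

variable {L δ φ η : ℝ} {I : Set ℝ}

theorem polar_mem_trapezoidWithBase (S : ConeAngles α θ) {r : ℝ} (hr : 0 < r) (hrL : r < L)
    (hφ : 0 ≤ φ) (hφθ : φ ≤ θ) : polar r φ ∈ trapezoidWithBase θ L := by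
  have hL : 0 < L := hr.trans hrL
  have hθ := S.theta_lt_pi_div_two
  have hsin_θ := S.sin_theta_pos
  have hcos : 0.66585 ≤ cos φ := S.cos_theta_ge.trans
    (Real.cos_le_cos_of_nonneg_of_le_pi hφ (by linarith [Real.pi_pos]) hφθ)
  have hsin : 0 ≤ sin φ := Real.sin_nonneg_of_nonneg_of_le_pi hφ (by linarith [Real.pi_pos])
  have hsin' : sin φ ≤ sin θ :=
    Real.sin_le_sin_of_le_of_le_pi_div_two (by linarith [Real.pi_pos]) hθ.le hφθ
  have hsq : (r * cos φ) ^ 2 + (r * sin φ) ^ 2 = r ^ 2 := by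
    linear_combination r ^ 2 * Real.sin_sq_add_cos_sq φ
  rw [mem_trapezoidWithBase_iff hL.le, polar_re, polar_im, hsq]
  refine ⟨by positivity, ?_, by gcongr, by nlinarith [mul_pos hr hL]⟩
  calc r * sin φ ≤ r * sin θ := by gcongr
    _ < L * sin θ := by gcongr

theorem norm_polar_sub_polar_lt_of_mem (S : ConeAngles α θ) (hI : IsAngleCell α θ I)
    (hL : 0 < L) (hδ : 0 < δ) (hδL : δ ≤ L) (hφ : φ ∈ I) (hη : η ∈ I) :
    ‖polar L φ - polar δ η‖ < L := by
  have hcos := le_cos_of_abs_le ((hI.abs_sub_le hφ hη).trans S.le)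
  exact norm_polar_sub_polar_lt hL.le hδ (by nlinarith)

theorem two_mul_re_le_of_notMem_trapezoidWithBase (S : ConeAngles α θ) (hI : IsAngleCell α θ I)
    (hL : 0 < L) (hδ : 0 < δ) (hδL : δ ≤ L) (hφ : φ ∈ I) (hη : η ∈ I)
    (him : 0 ≤ (polar L φ - polar δ η).im)
    (hT : polar L φ - polar δ η ∉ trapezoidWithBase θ L) :
    2 * L * (polar L φ - polar δ η).re ≤ ‖polar L φ - polar δ η‖ ^ 2 := by
  have hα := S.pos
  have hα' := S.le
  have hθ := S.theta_lt_pi_div_two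
  have hpi := Real.pi_pos
  have hη0 : 0 ≤ η := hI.nonneg hα.le hη
  have hsin : 0 ≤ sin η := Real.sin_nonneg_of_nonneg_of_le_pi hη0 (by linarith [hI.le hη])
  have hheight : (polar L φ - polar δ η).im < L * sin θ := by
    rw [Complex.sub_im, polar_im, polar_im]
    obtain rfl | hlt := (hI.le hφ).eq_or_lt
    · have hη_pos : 0 < η := by linarith [(abs_le.1 (hI.abs_sub_le hφ hη)).2, S.theta_gt]
      have hsin_pos : 0 < sin η := Real.sin_pos_of_pos_of_lt_pi hη_pos (by linarith [hI.le hη])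
      linarith [mul_pos hδ hsin_pos]
    · have hsin_lt : sin φ < sin θ := Real.sin_lt_sin_of_lt_of_le_pi_div_two
        (by linarith [hI.nonneg hα.le hφ]) hθ.le hlt
      linarith [mul_lt_mul_of_pos_left hsin_lt hL, mul_nonneg hδ.le hsin]
  have hdisc := norm_polar_sub_polar_lt_of_mem S hI hL hδ hδL hφ hη
  by_contra! h
  rw [norm_lt_iff_sq hL.le] at hdisc
  rw [sq_norm_eq] at h
  exact hT ((mem_trapezoidWithBase_iff hL.le).2 ⟨him, hheight, hdisc, h⟩)

theorem polar_sub_polar_mem_lowRegion (S : ConeAngles α θ) (hI : IsAngleCell α θ I)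
    (hL : 0 < L) (hδ : 0 < δ) (hδL : δ ≤ L) (hφ : φ ∈ I) (hη : η ∈ I)
    (him : (polar L φ - polar δ η).im < 0) : polar L φ - polar δ η ∈ lowRegion L := by
  have hpi := Real.pi_pos
  have hθ := S.theta_lt_pi_div_two
  have hφ0 := hI.nonneg S.pos.le hφ
  have hη0 := hI.nonneg S.pos.le hη
  have hηθ := hI.le hη
  refine ⟨him.le, him.le.trans ?_, (norm_polar_sub_polar_lt_of_mem S hI hL hδ hδL hφ hη).le⟩
  rw [Complex.sub_im, polar_im, polar_im] at him
  rw [Complex.sub_re, polar_re, polar_re, sub_nonneg]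
  have hφη : φ ≤ η := by
    by_contra! h
    have hsin : sin η ≤ sin φ :=
      Real.sin_le_sin_of_le_of_le_pi_div_two (by linarith) (by linarith [hI.le hφ]) h.le
    have hsin_η : 0 ≤ sin η := Real.sin_nonneg_of_nonneg_of_le_pi hη0 (by linarith)
    linarith [mul_le_mul hδL hsin hsin_η hL.le]
  exact mul_le_mul hδL (Real.cos_le_cos_of_nonneg_of_le_pi hφ0 (by linarith) hφη)
    (Real.cos_nonneg_of_mem_Icc ⟨by linarith, by linarith⟩) hL.le

theorem walkWithin_of_mem_arc (S : ConeAngles α θ) (hA : 0 ≤ A) {P : Finset ℂ}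
    {G : SimpleGraph ℂ} {u e v v' : ℂ} {σ : Bool} {φ' : ℝ}
    (hE : ∀ p ∈ P, ∀ q ∈ P, dist p q < L → SpansArcHits α θ A P G p q)
    (he : IsConeDirection α e) (hT : ∀ z ∈ P, frame u e σ z ∉ trapezoidWithBase θ L) (hL : 0 < L)
    (hI : IsAngleCell α θ I) (hφ : φ ∈ I) (hφ' : φ' ∈ I) (hv : v ∈ P) (hv' : v' ∈ P)
    (hF : frame u e σ v = polar L φ) (hF' : frame u e σ v' = polar L φ') :
    WalkWithin G v v' (A * (1 + 26.06 * α) * (L * |φ - φ'|)) := by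
  wlog h : φ ≤ φ' generalizing φ φ' v v'
  · rw [abs_sub_comm]
    exact (this hφ' hφ hv' hv hF' hF (le_of_not_ge h)).symm
  have hmid_sub : (φ + φ') / 2 - (φ' - φ) / 2 = φ := by ring
  have hmid_add : (φ + φ') / 2 + (φ' - φ) / 2 = φ' := by ring
  have hclose := abs_le.1 (hI.abs_sub_le hφ' hφ)
  have hφ0 := hI.nonneg S.pos.le hφ
  have hwalk := walkWithin_of_arc S hA hE he hT hL (m := (φ + φ') / 2) (γ := (φ' - φ) / 2)
    (by linarith) (by linarith) (by linarith) (by rw [hmid_add]; exact hI.le hφ')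
    (by
      rw [hmid_add, hmid_sub]
      exact (hI.subset_Iic_or_subset_Ici S.pos.le).imp (fun hI => hI hφ') fun hI => hI hφ)
    hv hv' (by rwa [hmid_sub]) (by rwa [hmid_add])
  rwa [mul_assoc 2 L, mul_left_comm 2 L, mul_div_cancel₀ _ two_ne_zero, ← abs_of_nonneg
    (sub_nonneg.2 h), abs_sub_comm] at hwalk

end CriticalArc

theorem cos_sub_cos_add_mul_sin_sub_sin_le (x y : ℝ) :
    cos y - cos x + 13.03 * (sin x - sin y) ≤ 13.2 * |x - y| := by
  have hchord : (cos y - cos x) ^ 2 + (sin x - sin y) ^ 2 ≤ |x - y| ^ 2 := by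
    rw [sq_abs]
    linarith [Real.one_sub_sq_div_two_le_cos (x := x - y), Real.cos_sub x y,
      Real.sin_sq_add_cos_sq x, Real.sin_sq_add_cos_sq y]
  refine abs_le_of_sq_le_sq' ?_ (by positivity) |>.2
  nlinarith only [hchord, sq_nonneg (13.03 * (cos y - cos x) - (sin x - sin y)),
    sq_nonneg |x - y|]

section Budget

variable {L δ φ φ' η : ℝ} {I : Set ℝ}

theorem tie_cost_le (S : ConeAngles α θ) (hA : 0 ≤ A) (hL : 0 ≤ L) :
    A * (1 + 26.06 * α) * (L * |φ - φ'|) ≤ A * L * (2.95 * |φ - φ'|) := by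
  have hfactor : 1 + 26.06 * α ≤ 2.95 := by linarith [S.le]
  calc A * (1 + 26.06 * α) * (L * |φ - φ'|) = A * L * ((1 + 26.06 * α) * |φ - φ'|) := by ring
    _ ≤ A * L * (2.95 * |φ - φ'|) := by gcongr

theorem add_mul_potential_le_of_le (hA : 0 ≤ A) (hA1 : 1 ≤ A * (1 - 13.2 * α)) (hL : 0 ≤ L)
    (hδ : 0 ≤ δ) (hη0 : 0 ≤ η) (hη : η ≤ α) :
    δ + A * ((polar L φ - polar δ η).re - 13.03 * (polar L φ - polar δ η).im)
      ≤ A * L - 13.03 * (A * L * sin φ) := by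
  have hsteep := cos_sub_cos_add_mul_sin_sub_sin_le η 0
  rw [Real.cos_zero, Real.sin_zero, sub_zero, sub_zero, abs_of_nonneg hη0] at hsteep
  have hδ_coeff : 1 - A * (cos η - 13.03 * sin η) ≤ 0 := by nlinarith
  have hcos : A * L * cos φ ≤ A * L * 1 := by gcongr; exact Real.cos_le_one φ
  rw [Complex.sub_re, Complex.sub_im, polar_re, polar_im, polar_re, polar_im]
  linarith [mul_nonpos_of_nonneg_of_nonpos hδ hδ_coeff]

theorem add_mul_potential_le (hA : 0 ≤ A) (hA1 : 1 ≤ A * (1 - 13.2 * α))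
    (hδ : 0 ≤ δ) (hδL : δ ≤ L) (hφ : 0 ≤ sin φ) (hη : |η - φ| ≤ α) :
    δ + A * ((polar L φ - polar δ η).re - 13.03 * (polar L φ - polar δ η).im) ≤ A * L := by
  have hδ_coeff : 1 + A * (cos φ - cos η + 13.03 * (sin η - sin φ)) - A ≤ 0 := by
    nlinarith [cos_sub_cos_add_mul_sin_sub_sin_le η φ]
  have hLδ : 0 ≤ (L - δ) * (1 - cos φ + 13.03 * sin φ) :=
    mul_nonneg (sub_nonneg.2 hδL) (by linarith [Real.cos_le_one φ])
  rw [Complex.sub_re, Complex.sub_im, polar_re, polar_im, polar_re, polar_im]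
  linarith [mul_nonpos_of_nonneg_of_nonpos hδ hδ_coeff, mul_nonneg hA hLδ]

theorem budget_below (S : ConeAngles α θ) (hA : 0 ≤ A) (hA1 : 1 ≤ A * (1 - 13.2 * α))
    (hI : IsAngleCell α θ I) (hφ : φ ∈ I) (hφ' : φ' ∈ I) (hη : η ∈ I) (hδ : 0 ≤ δ) (hδL : δ ≤ L) :
    A * (1 + 26.06 * α) * (L * |φ - φ'|)
        + (δ + A * ((polar L φ' - polar δ η).re - 13.03 * (polar L φ' - polar δ η).im))
      ≤ A * L + 3 * A * L * min (sin φ) (sin α) := by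
  have hL : 0 ≤ L := hδ.trans hδL
  have hα := S.pos
  have hα' := S.le
  have hφ0 := hI.nonneg hα.le hφ
  have hφ0' := hI.nonneg hα.le hφ'
  have hpi := Real.pi_gt_d4
  have htie := tie_cost_le S hA hL (φ := φ) (φ' := φ')
  rcases hI.subset_Iic_or_subset_Ici hα.le with hsmall | hlarge
  · have hpotential := add_mul_potential_le_of_le hA hA1 hL hδ
      (hI.nonneg hα.le hη) (hsmall hη) (φ := φ')
    have hmin : min (sin φ) (sin α) = sin φ := min_eq_left
      (Real.sin_le_sin_of_le_of_le_pi_div_two (by linarith) (by linarith) (hsmall hφ))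
    have htie_le : 2.95 * |φ - φ'| ≤ 3 * sin φ + 13.03 * sin φ' := by
      have habs : |φ - φ'| ≤ φ + φ' := abs_le.2 ⟨by linarith, by linarith⟩
      linarith [mul_le_sin hφ0 ((hsmall hφ).trans hα'), mul_le_sin hφ0' ((hsmall hφ').trans hα')]
    rw [hmin]
    linarith [mul_le_mul_of_nonneg_left htie_le (mul_nonneg hA hL)]
  · have hpotential := add_mul_potential_le hA hA1 hδ hδL (hI.sin_nonneg S hφ')
      (hI.abs_sub_le hη hφ')
    have hmin : min (sin φ) (sin α) = sin α := min_eq_right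
      (Real.sin_le_sin_of_le_of_le_pi_div_two (by linarith)
        (by linarith [hI.le hφ, S.theta_lt_pi_div_two]) (hlarge hφ))
    have htie_le : 2.95 * |φ - φ'| ≤ 3 * sin α := by
      linarith [hI.abs_sub_le hφ hφ', S.sin_alpha_ge]
    rw [hmin]
    linarith [mul_le_mul_of_nonneg_left htie_le (mul_nonneg hA hL)]

theorem le_mul_of_quadratic_le {T c s p q p₀ : ℝ} (hL : 0 < L) (hs : 0 ≤ s)
    (hp : p ≤ L) (hq : 0 ≤ q) (hqT : q ≤ T * (L - p)) (hc : 1 < 2 * c)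
    (h : 2 * L * (p * c - q * s) ≤ p ^ 2 + q ^ 2)
    (hp₀ : p₀ ^ 2 + T ^ 2 * (1 - p₀) ^ 2 - 2 * p₀ * c + 2 * T * s * (1 - p₀) < 0) :
    p ≤ p₀ * L := by
  -- The quadratic `f` is convex and negative at `p₀ * L` and at `L`, hence negative in between.
  by_contra! hlt
  let f (x : ℝ) : ℝ :=
    x ^ 2 + T ^ 2 * (L - x) ^ 2 - 2 * L * (x * c) + 2 * L * (T * (L - x) * s)
  have hf : 0 ≤ f p := by
    have hq_sq : q ^ 2 ≤ (T * (L - p)) ^ 2 := by gcongr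
    have hqs : 2 * L * (q * s) ≤ 2 * L * (T * (L - p) * s) := by gcongr
    simp only [f]
    linarith
  have hf_left : f (p₀ * L) < 0 := by
    have : f (p₀ * L) = L ^ 2 *
        (p₀ ^ 2 + T ^ 2 * (1 - p₀) ^ 2 - 2 * p₀ * c + 2 * T * s * (1 - p₀)) := by ring
    rw [this]
    exact mul_neg_of_pos_of_neg (by positivity) hp₀
  have hf_right : f L < 0 := by
    have : f L = L ^ 2 * (1 - 2 * c) := by ring
    rw [this]
    exact mul_neg_of_pos_of_neg (by positivity) (by linarith)
  have hconvex : (L - p₀ * L) * f p = (L - p) * f (p₀ * L) + (p - p₀ * L) * f L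
      - (1 + T ^ 2) * ((L - p) * (p - p₀ * L) * (L - p₀ * L)) := by ring
  have hp₀_pos : 0 < p - p₀ * L := sub_pos.2 hlt
  have hLp : 0 ≤ L - p := sub_nonneg.2 hp
  have hsum : 0 < L - p₀ * L := by linarith
  linarith [hconvex, mul_nonneg hsum.le hf, mul_nonpos_of_nonneg_of_nonpos hLp hf_left.le,
    mul_neg_of_pos_of_neg hp₀_pos hf_right,
    show 0 ≤ (1 + T ^ 2) * ((L - p) * (p - p₀ * L) * (L - p₀ * L)) by positivity]

theorem sq_norm_polar_sub_polar (L δ φ η : ℝ) : ‖polar L φ - polar δ η‖ ^ 2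
    = (L - δ * cos (η - φ)) ^ 2 + (δ * |sin (η - φ)|) ^ 2 := by
  rw [sq_norm_eq, Complex.sub_re, Complex.sub_im, polar_re, polar_im, polar_re, polar_im, mul_pow,
    sq_abs, Real.cos_sub, Real.sin_sub]
  linear_combination (L ^ 2 - δ ^ 2 * (sin η ^ 2 + cos η ^ 2)) * Real.sin_sq_add_cos_sq φ

theorem le_re_polar_sub_polar (L φ η : ℝ) (hδ : 0 ≤ δ) (hφ : 0 ≤ sin φ) :
    (L - δ * cos (η - φ)) * cos φ - δ * |sin (η - φ)| * sin φ
      ≤ (polar L φ - polar δ η).re := by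
  have hre : (polar L φ - polar δ η).re
      = (L - δ * cos (η - φ)) * cos φ + δ * sin (η - φ) * sin φ := by
    rw [Complex.sub_re, polar_re, polar_re, Real.cos_sub, Real.sin_sub]
    linear_combination δ * cos η * Real.sin_sq_add_cos_sq φ
  have habs := mul_le_mul_of_nonneg_right
    (mul_le_mul_of_nonneg_left (neg_abs_le (sin (η - φ))) hδ) hφ
  linarith

/-- The hypothesis `hleft` says that the point lies to the left of the trapezoid. -/
theorem norm_polar_sub_polar_le {c s κ κ' : ℝ} (hα : 0 < α) (hα' : α ≤ 0.0748) (hL : 0 < L)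
    (hδ : 0 ≤ δ) (hδL : δ ≤ L) (hη : |η - φ| ≤ α) (hφ : 0 ≤ sin φ)
    (hleft : 2 * L * (polar L φ - polar δ η).re ≤ ‖polar L φ - polar δ η‖ ^ 2)
    (hc : c ≤ cos φ) (hs : sin φ ≤ s) (hc_gt : 1 < 2 * c) (hκ : 0 ≤ κ) (hκ_le : κ ≤ 2)
    (hκc : κ ^ 2 * α + 1.0063 * α - 2 * κ * c + 2.0062 * s * (1 - κ * α) < 0)
    (hκ' : 0 ≤ κ') (hκκ' : κ ^ 2 + 1.0063 ≤ κ' ^ 2) :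
    ‖polar L φ - polar δ η‖ ≤ κ' * α * L := by
  have hcos := le_cos_of_abs_le (hη.trans hα')
  have hsin : |sin (η - φ)| ≤ α := Real.abs_sin_le_abs.trans hη
  have hre := le_re_polar_sub_polar L φ η hδ hφ
  have hnorm := sq_norm_polar_sub_polar L δ φ η
  have hp0 : 0 ≤ L - δ * cos (η - φ) :=
    sub_nonneg.2 ((mul_le_of_le_one_right hδ (Real.cos_le_one _)).trans hδL)
  have hpL : L - δ * cos (η - φ) ≤ L := sub_le_self L (mul_nonneg hδ (by linarith))
  have hq0 : 0 ≤ δ * |sin (η - φ)| := by positivity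
  have hqT : δ * |sin (η - φ)| ≤ 1.0031 * α * (L - (L - δ * cos (η - φ))) := by
    rw [sub_sub_cancel, mul_left_comm]
    gcongr
    linarith [mul_le_mul_of_nonneg_left hcos hα.le]
  generalize L - δ * cos (η - φ) = p at *
  generalize δ * |sin (η - φ)| = q at *
  have hκα : κ * α ≤ 1 := (mul_le_mul hκ_le hα' hα.le zero_le_two).trans (by norm_num)
  have hκα0 : 0 ≤ κ * α := by positivity
  have hout : 2 * L * (p * c - q * s) ≤ p ^ 2 + q ^ 2 := by
    have hpq : p * c - q * s ≤ p * cos φ - q * sin φ := by gcongr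
    exact (mul_le_mul_of_nonneg_left (hpq.trans hre) (by positivity)).trans (hleft.trans_eq hnorm)
  have hp : p ≤ κ * α * L := by
    refine le_mul_of_quadratic_le hL (hφ.trans hs) hpL hq0 hqT hc_gt hout ?_
    have hsq : (1 - κ * α) ^ 2 ≤ 1 := pow_le_one₀ (sub_nonneg.2 hκα) (by linarith)
    linarith [mul_neg_of_pos_of_neg hα hκc, mul_le_mul_of_nonneg_left hsq (sq_nonneg α),
      sq_pos_of_pos hα]
  have hq : q ≤ 1.0031 * α * L := hqT.trans (by gcongr; linarith)
  rw [← abs_of_nonneg (show 0 ≤ κ' * α * L by positivity), ← abs_norm, ← sq_le_sq, hnorm]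
  calc p ^ 2 + q ^ 2 ≤ (κ * α * L) ^ 2 + (1.0031 * α * L) ^ 2 := by gcongr
    _ = (κ ^ 2 + 1.0031 ^ 2) * (α * L) ^ 2 := by ring
    _ ≤ κ' ^ 2 * (α * L) ^ 2 := by gcongr; linarith
    _ = (κ' * α * L) ^ 2 := by ring

theorem budget_left (S : ConeAngles α θ) (hA : 0 ≤ A) (hA1 : 1 ≤ A * (1 - 13.2 * α))
    (hI : IsAngleCell α θ I) (hφ : φ ∈ I) (hφ' : φ' ∈ I) (hη : η ∈ I) (hL : 0 < L) (hδ : 0 ≤ δ)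
    (hδL : δ ≤ L)
    (hleft : 2 * L * (polar L φ' - polar δ η).re ≤ ‖polar L φ' - polar δ η‖ ^ 2) :
    8.5 * A * ‖polar L φ' - polar δ η‖ + δ + A * (1 + 26.06 * α) * (L * |φ - φ'|)
      ≤ A * L + 3 * A * L * min (sin φ) (sin α) := by
  have hα := S.pos
  have hα' := S.le
  have hpi := Real.pi_gt_d4
  have hθ := S.theta_lt_pi_div_two
  have hφ0' := hI.nonneg hα.le hφ'
  have hδ_le : δ ≤ A * L * (1 - 13.2 * α) := by nlinarith
  have htie : A * (1 + 26.06 * α) * (L * |φ - φ'|) ≤ A * L * (2.95 * α) :=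
    (tie_cost_le S hA hL.le).trans (by gcongr; exact hI.abs_sub_le hφ hφ')
  have hnorm_le {c s κ κ' : ℝ} := norm_polar_sub_polar_le (c := c) (s := s) (κ := κ) (κ' := κ')
    hα hα' hL hδ hδL (hI.abs_sub_le hη hφ') (hI.sin_nonneg S hφ') hleft
  rcases hI.subset_Iic_or_subset_Ici hα.le with hsmall | hlarge
  · have hle : φ' ≤ α := hsmall hφ'
    have hnorm : ‖polar L φ' - polar δ η‖ ≤ 1.1 * α * L :=
      hnorm_le (c := 0.997) (s := 0.0748) (κ := 0.2)
        (le_cos_of_abs_le (by rw [abs_of_nonneg hφ0']; linarith))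
        ((Real.sin_le hφ0').trans (by linarith)) (by norm_num) (by norm_num) (by norm_num)
        (by linarith) (by norm_num) (by norm_num)
    have hmin : 0 ≤ min (sin φ) (sin α) :=
      le_min (hI.sin_nonneg S hφ) (by linarith [S.sin_alpha_ge])
    have hAnorm : 8.5 * A * ‖polar L φ' - polar δ η‖ ≤ 8.5 * A * (1.1 * α * L) := by gcongr
    have hAL : 0 ≤ A * L * α := by positivity
    have hAmin : 0 ≤ 3 * A * L * min (sin φ) (sin α) := by positivity
    linarith
  · have hnorm : ‖polar L φ' - polar δ η‖ ≤ 1.55 * α * L :=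
      hnorm_le (c := 0.66585) (s := 0.7468) (κ := 1.18)
        (S.cos_theta_ge.trans (Real.cos_le_cos_of_nonneg_of_le_pi hφ0' (by linarith) (hI.le hφ')))
        ((Real.sin_le_sin_of_le_of_le_pi_div_two (by linarith) hθ.le (hI.le hφ')).trans
          S.sin_theta_le) (by norm_num) (by norm_num) (by norm_num) (by linarith) (by norm_num)
        (by norm_num)
    have hmin : 0.999 * α ≤ min (sin φ) (sin α) :=
      le_min (S.sin_alpha_ge.trans (Real.sin_le_sin_of_le_of_le_pi_div_two (by linarith)
        (by linarith [hI.le hφ]) (hlarge hφ))) S.sin_alpha_ge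
    have hAnorm : 8.5 * A * ‖polar L φ' - polar δ η‖ ≤ 8.5 * A * (1.55 * α * L) := by gcongr
    have hAL : 0 ≤ A * L * α := by positivity
    have hAmin : 3 * A * L * (0.999 * α) ≤ 3 * A * L * min (sin φ) (sin α) := by gcongr
    linarith

end Budget

theorem walkWithin_of_arcHit (S : ConeAngles α θ) (hA : 0 ≤ A) (hA1 : 1 ≤ A * (1 - 13.2 * α))
    {P : Finset ℂ} {G : SimpleGraph ℂ} (hG : HasYaoYaoSteps α P G) {u v e : ℂ} {σ : Bool} {φ : ℝ}
    (hE : ∀ p ∈ P, ∀ q ∈ P, dist p q < dist u v → SpansArcHits α θ A P G p q)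
    (hu : u ∈ P) (hv : v ∈ P) (huv : u ≠ v) (he : IsConeDirection α e)
    (hF : frame u e σ v = polar (dist u v) φ) (hφ : 0 ≤ φ) (hφθ : φ ≤ θ)
    (hφ' : 0 < φ ∨ σ = false) (hφθ' : φ < θ ∨ σ = true)
    (hT : ∀ z ∈ P, frame u e σ z ∉ trapezoidWithBase θ (dist u v)) :
    WalkWithin G u v (A * dist u v + 3 * A * dist u v * min (sin φ) (sin α)) := by
  obtain ⟨j, v', hv', w, hw, hvj, hv'j, hv'w, hd, hδ, hadj⟩ := hG u hu v hv huv
  obtain ⟨I, hI, hφI, hcell⟩ := exists_isAngleCell S he hvj huv hF hφ hφθ hφ' hφθ'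
  obtain ⟨φ', hφ'I, hF'⟩ := hcell u v' hv'j
  obtain ⟨η, hηI, hFw'⟩ := hcell w v' hv'w
  have hL : 0 < dist u v := dist_pos.2 huv
  have hδ0 : 0 < dist w v' := dist_pos.2 hadj.ne
  have hd_eq : dist u v' = dist u v := by
    refine hd.eq_or_lt.resolve_right fun hlt => hT v' hv' ?_
    rw [hF']
    exact polar_mem_trapezoidWithBase S (hδ0.trans_le hδ) hlt (hI.nonneg S.pos.le hφ'I) (hI.le hφ'I)
  rw [hd_eq] at hδ hF'
  have hFw : frame u e σ w = polar (dist u v) φ' - polar (dist w v') η := by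
    rw [← hF', ← hFw', frame_eq_sub u e σ w v', sub_sub_cancel]
  have hw_norm := norm_frame he.norm_eq_one u σ w
  have hw_lt : dist u w < dist u v := by
    rw [← hw_norm, hFw]
    exact norm_polar_sub_polar_lt_of_mem S hI hL hδ0 hδ hφ'I hηI
  have tie := walkWithin_of_mem_arc S hA hE he hT hL hI hφI hφ'I hv hv' hF hF'
  have edge := WalkWithin.of_adj hadj
  rcases lt_or_ge (frame u e σ w).im 0 with him | him
  · have hlow := polar_sub_polar_mem_lowRegion S hI hL hδ0 hδ hφ'I hηI (hFw ▸ him)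
    have walk := walkWithin_of_mem_lowRegion S hA hE hu he (fun z hz _ => hT z hz) w hw
      (hFw ▸ hlow) hw_lt
    rw [hFw] at walk
    exact (tie.trans (edge.symm.trans walk)).symm.mono
      (budget_below S hA hA1 hI hφI hφ'I hηI hδ0.le hδ)
  · have hleft := two_mul_re_le_of_notMem_trapezoidWithBase S hI hL hδ0 hδ hφ'I hηI (hFw ▸ him)
      (hFw ▸ hT w hw)
    have walk := walkWithin_of_dist_lt S hA hE hu hw hw_lt
    rw [← hw_norm, hFw] at walk
    exact ((walk.trans edge).trans tie.symm).mono
      (budget_left S hA hA1 hI hφI hφ'I hηI hL hδ0.le hδ hleft)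

theorem neg_conj_sub_ofReal_mem_trapezoidWithBase_iff {L : ℝ} {ζ : ℂ} :
    -conj (ζ - L) ∈ trapezoidWithBase θ L ↔ ζ ∈ trapezoidWithBase θ L := by
  have hnorm : ‖-conj (ζ - L)‖ = ‖ζ - L‖ := by rw [norm_neg, RCLike.norm_conj]
  have hnorm_sub : ‖-conj (ζ - L) - L‖ = ‖ζ‖ := by
    rw [← RCLike.norm_conj ζ, ← norm_neg (conj ζ)]
    simp
  have him : (-conj (ζ - L)).im = ζ.im := by simp
  simp only [trapezoidWithBase, Set.mem_ofPred_eq, hnorm, hnorm_sub, him]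
  tauto

theorem spansArcHits (S : ConeAngles α θ) (hA : 0 ≤ A) (hA1 : 1 ≤ A * (1 - 13.2 * α))
    {P : Finset ℂ} {G : SimpleGraph ℂ} (hG : HasYaoYaoSteps α P G) {u v : ℂ} (hu : u ∈ P)
    (hv : v ∈ P) : SpansArcHits α θ A P G u v := by
  suffices h : ∀ x ∈ P ×ˢ P, SpansArcHits α θ A P G x.1 x.2 from
    h (u, v) (Finset.mk_mem_product hu hv)
  refine finset_strong_induction _ (fun x => dist x.1 x.2) ?_
  rintro ⟨u, v⟩ huv ih e σ φ he hφ hφθ hφθ' hF hT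
  obtain ⟨hu, hv⟩ := Finset.mem_product.1 huv
  replace ih : ∀ p ∈ P, ∀ q ∈ P, dist p q < dist u v → SpansArcHits α θ A P G p q :=
    fun p hp q hq => ih (p, q) (Finset.mk_mem_product hp hq)
  dsimp only at hu hv hF hT ⊢
  rcases eq_or_ne u v with rfl | hne
  · exact .refl _ (by simp)
  by_cases hφ' : 0 < φ ∨ σ = false
  · exact walkWithin_of_arcHit S hA hA1 hG ih hu hv hne he hF hφ hφθ hφ' hφθ' hT
  -- At the corner of the reflected trapezoid, `v` is on the boundary of the wrong cone of `u`, but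
  -- exchanging `u` and `v` turns the trapezoid into an unreflected one.
  obtain ⟨hφ_le, hσ⟩ := not_or.1 hφ'
  obtain rfl : φ = 0 := le_antisymm (not_lt.1 hφ_le) hφ
  obtain rfl : σ = true := by simpa using hσ
  obtain ⟨k, hk⟩ := S.exists_half_turn
  have hFv : frame u e true v = dist u v := by simpa [polar] using hF
  have hflip (z : ℂ) : frame v (-e) false z = -conj (frame u e true z - dist u v) := by
    rw [← Bool.not_true, frame_neg_not u e true v z, hFv]
  rw [dist_comm u v] at ih hflip hT ⊢
  refine (walkWithin_of_arcHit S hA hA1 hG ih hv hu hne.symm (he.neg hk) (σ := false) ?_ le_rfl hφθ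
    (.inr rfl) (.inl S.theta_pos) fun z hz => ?_).symm
  · rw [hflip, frame_self]
    simp [polar]
  · rw [hflip, neg_conj_sub_ofReal_mem_trapezoidWithBase_iff]
    exact hT z hz

/-! ### Edges of the trapezoidal Yao graph -/

theorem continuous_conjIf (σ : Bool) : Continuous (conjIf σ) := by
  cases σ
  · exact continuous_id
  · exact Complex.continuous_conj

theorem conjIf_smul (σ : Bool) (r : ℝ) (z : ℂ) : conjIf σ (r • z) = r • conjIf σ z := by
  cases σ <;> simp [conjIf]

theorem frame_add_mul_conjIf {e : ℂ} (he : ‖e‖ = 1) (u : ℂ) (σ : Bool) (ζ : ℂ) :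
    frame u e σ (u + e * conjIf σ ζ) = ζ := by
  have hunit : e * conj e = 1 := by simp [Complex.mul_conj, Complex.normSq_eq_norm_sq, he]
  rw [frame, add_sub_cancel_left, mul_right_comm, hunit, one_mul]
  cases σ <;> simp [conjIf]

theorem add_mul_conjIf_frame {e : ℂ} (he : ‖e‖ = 1) (u : ℂ) (σ : Bool) (z : ℂ) :
    u + e * conjIf σ (frame u e σ z) = z :=
  frame_injective he u σ (frame_add_mul_conjIf he u σ _)

theorem place_image_conjIf (u : ℂ) (μ γ : ℝ) (σ : Bool) (Γ : Set ℂ) :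
    place u μ γ (conjIf σ '' Γ) = (fun ζ => u + polar 1 γ * conjIf σ ζ) '' (μ • Γ) := by
  rw [place, ← Set.image_smul, Set.image_image, Set.image_image]
  congr! 2 with ζ
  rw [conjIf_smul, polar, Complex.real_smul, Complex.ofReal_one]
  ring

theorem mem_smul_trapezoid {μ : ℝ} {ζ : ℂ} (hμ : 0 < μ) (h : ζ ∈ trapezoidWithBase θ μ)
    (him : 0 < ζ.im) : ζ ∈ μ • trapezoid θ := by
  have hre := re_pos_of_mem_trapezoidWithBase hμ.le h
  obtain ⟨-, hheight, hnorm, hnorm_sub⟩ := h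
  have hμ' : 0 < μ⁻¹ := inv_pos.2 hμ
  rw [Set.mem_smul_set_iff_inv_smul_mem₀ hμ.ne']
  have hsub : μ⁻¹ • ζ - 1 = μ⁻¹ • (ζ - μ) := by
    rw [smul_sub, Complex.real_smul (z := μ), ← Complex.ofReal_mul, inv_mul_cancel₀ hμ.ne',
      Complex.ofReal_one]
  simp only [trapezoid, Set.mem_ofPred_eq, hsub, norm_smul, Complex.smul_re, Complex.smul_im,
    smul_eq_mul, Real.norm_of_nonneg hμ'.le, inv_mul_lt_iff₀ hμ, mul_one]
  exact ⟨by positivity, (Complex.re_le_norm ζ).trans_lt hnorm, by positivity, hheight, hnorm,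
    hnorm_sub⟩

theorem trapezoidWithBase_subset_closure {μ : ℝ} (hμ : 0 < μ) :
    trapezoidWithBase θ μ ⊆ closure (μ • trapezoid θ) := by
  rintro ζ ⟨him, hheight, hnorm, hnorm_sub⟩
  have hlim : Tendsto (fun t : ℝ => ζ + t * Complex.I) (𝓝[>] 0) (𝓝 ζ) := by
    have hcont : Continuous fun t : ℝ => ζ + t * Complex.I := by fun_prop
    exact (hcont.tendsto' 0 ζ (by simp)).mono_left nhdsWithin_le_nhds
  refine mem_closure_of_tendsto hlim ?_
  filter_upwards [((Complex.continuous_im.tendsto ζ).comp hlim).eventually_lt_const hheight,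
    hlim.norm.eventually_lt_const hnorm,
    (hlim.sub_const (μ : ℂ)).norm.eventually_lt_const hnorm_sub,
    self_mem_nhdsWithin] with t hheight hnorm hnorm_sub ht
  have him' : 0 < (ζ + t * Complex.I).im := by simpa using add_pos_of_nonneg_of_pos him ht
  exact mem_smul_trapezoid hμ ⟨him'.le, hheight, hnorm, hnorm_sub⟩ him'

theorem exists_lt_mem_trapezoidWithBase {L : ℝ} {ζ : ℂ} (hL : 0 < L)
    (h : ζ ∈ trapezoidWithBase θ L) : ∃ μ, 0 < μ ∧ μ < L ∧ ζ ∈ trapezoidWithBase θ μ := by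
  obtain ⟨him, hheight, hnorm, hnorm_sub⟩ := h
  have hid : Tendsto id (𝓝[<] L) (𝓝 L) := nhdsWithin_le_nhds
  have hsub : Tendsto (fun μ : ℝ => ‖ζ - μ‖) (𝓝[<] L) (𝓝 ‖ζ - L‖) := by
    have hcont : Continuous fun μ : ℝ => ‖ζ - μ‖ := by fun_prop
    exact (hcont.tendsto L).mono_left nhdsWithin_le_nhds
  have hev := (hid.eventually_const_lt hL).and <| eventually_mem_nhdsWithin.and <|
    ((hid.mul_const (sin θ)).eventually_const_lt hheight).and <|
      (hid.eventually_const_lt hnorm).and (hsub.eventually_lt hid hnorm_sub)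
  obtain ⟨μ, hμ, hμL, hheight, hnorm, hnorm_sub⟩ := hev.exists
  exact ⟨μ, hμ, hμL, him, hheight, hnorm, hnorm_sub⟩

theorem notMem_trapezoidWithBase_of_growth {P : Finset ℂ} {γ L : ℝ} {u : ℂ} {σ : Bool}
    (hL : 0 < L) (h : ∀ μ : ℝ, 0 < μ → μ < L → ∀ w ∈ P,
      w ∈ closure (place u μ γ (conjIf σ '' trapezoid θ)) → w = u) :
    ∀ z ∈ P, frame u (polar 1 γ) σ z ∉ trapezoidWithBase θ L := by
  intro z hz hzT
  have he : ‖polar 1 γ‖ = 1 := norm_polar zero_le_one γ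
  obtain ⟨μ, hμ, hμL, hzμ⟩ := exists_lt_mem_trapezoidWithBase hL hzT
  have hcont : Continuous fun ζ => u + polar 1 γ * conjIf σ ζ :=
    continuous_const.add (continuous_const.mul (continuous_conjIf σ))
  have hz_closure : z ∈ closure (place u μ γ (conjIf σ '' trapezoid θ)) := by
    rw [place_image_conjIf]
    refine image_closure_subset_closure_image hcont ?_
    exact ⟨_, trapezoidWithBase_subset_closure hμ hzμ, add_mul_conjIf_frame he u σ z⟩
  have hzu : z = u := h μ hμ hμL z hz hz_closure
  have hre := re_pos_of_mem_trapezoidWithBase hL.le hzT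
  rw [hzu, frame_self] at hre
  exact lt_irrefl _ hre

theorem walkWithin_of_growthHits (S : ConeAngles α θ) (hA : 0 ≤ A)
    (hA1 : 1 ≤ A * (1 - 13.2 * α)) {P : Finset ℂ} {G : SimpleGraph ℂ} (hG : HasYaoYaoSteps α P G)
    {u v : ℂ} (hu : u ∈ P) (hv : v ∈ P) {γ : ℝ} (he : IsConeDirection α (polar 1 γ)) {σ : Bool}
    {J : Set ℝ} (hJ : J ⊆ Set.Icc 0 θ) (hJ' : θ ∉ J ∨ σ = true)
    (h : GrowthHits P u γ (conjIf σ '' trapezoid θ) (conjIf σ '' unitArc J) v) :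
    WalkWithin G u v (A * (1 + 3 * α) * dist u v) := by
  obtain ⟨L, hL, hvL, hgrowth⟩ := h
  rw [place_image_conjIf] at hvL
  obtain ⟨_, ⟨_, ⟨φ, hφ, rfl⟩, rfl⟩, rfl⟩ := hvL
  set v := u + polar 1 γ * conjIf σ (L • Complex.exp (φ * Complex.I))
  have hF : frame u (polar 1 γ) σ v = polar L φ := by
    rw [frame_add_mul_conjIf he.norm_eq_one, polar, Complex.real_smul]
  have hdist : dist u v = L := by
    rw [← norm_frame he.norm_eq_one u σ v, hF, norm_polar hL.le]
  have hT := notMem_trapezoidWithBase_of_growth hL hgrowth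
  rw [← hdist] at hF hT
  have hφθ : φ < θ ∨ σ = true :=
    hJ'.imp_left fun hθ => (hJ hφ).2.lt_of_ne fun heq => hθ (heq ▸ hφ)
  refine (spansArcHits S hA hA1 hG hu hv _ σ φ he (hJ hφ).1 (hJ hφ).2 hφθ hF hT).mono ?_
  have hmin : min (sin φ) (sin α) ≤ α := (min_le_right _ _).trans (Real.sin_le S.pos.le)
  calc A * dist u v + 3 * A * dist u v * min (sin φ) (sin α)
      ≤ A * dist u v + 3 * A * dist u v * α := by gcongr
    _ = A * (1 + 3 * α) * dist u v := by ring

theorem image_conj_unitArc (J : Set ℝ) : conj '' unitArc J = unitArc (-J) := by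
  rw [unitArc, unitArc, ← Set.image_neg_eq_neg, Set.image_image, Set.image_image]
  simp [← Complex.exp_conj]

theorem walkWithin_of_tyEdge {n : ℕ} (S : ConeAngles (2 * π / n) (tyAngle n)) (hA : 0 ≤ A)
    (hA1 : 1 ≤ A * (1 - 13.2 * (2 * π / n))) {P : Finset ℂ} {G : SimpleGraph ℂ}
    (hG : HasYaoYaoSteps (2 * π / n) P G) {u v : ℂ} (h : TYEdge n P u v) :
    WalkWithin G u v (A * (1 + 3 * (2 * π / n)) * dist u v) := by
  obtain ⟨hu, hv, j, -, h⟩ := h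
  have he : IsConeDirection (2 * π / n) (polar 1 (2 * j * π / n)) :=
    ⟨j, by rw [Int.cast_natCast]; congr 1; ring⟩
  rcases h with h | h
  · refine walkWithin_of_growthHits S hA hA1 hG hu hv he (σ := false) Set.Ico_subset_Icc_self
      (.inl fun hθ => lt_irrefl _ hθ.2) ?_
    rwa [show conjIf false = id from rfl, Set.image_id, Set.image_id]
  · refine walkWithin_of_growthHits S hA hA1 hG hu hv he (σ := true) subset_rfl (.inr rfl) ?_
    rwa [show conjIf true = conj from rfl, image_conj_unitArc, Set.neg_Icc, neg_zero]

theorem coneAngles_of_le {k : ℕ} (hk : 42 ≤ k) :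
    ConeAngles (2 * π / (2 * k : ℕ)) (tyAngle (2 * k)) := by
  have hk42 : (42 : ℝ) ≤ k := by exact_mod_cast hk
  have half_turn : k * (2 * π / (2 * k : ℕ)) = π := by push_cast; field_simp
  have hpos : 0 < 2 * π / (2 * k : ℕ) := by push_cast; positivity
  have ceil_ge : (k : ℝ) ≤ 4 * ⌈((2 * k : ℕ) : ℝ) / 8⌉₊ := by
    have := Nat.le_ceil (((2 * k : ℕ) : ℝ) / 8)
    push_cast at this ⊢
    linarith
  have ceil_le : 4 * (⌈((2 * k : ℕ) : ℝ) / 8⌉₊ : ℝ) ≤ k + 3 := by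
    have := Nat.ceil_lt_add_one (show (0 : ℝ) ≤ ((2 * k : ℕ) : ℝ) / 8 by positivity)
    have hlt : 4 * ⌈((2 * k : ℕ) : ℝ) / 8⌉₊ < k + 4 := by
      rify
      push_cast at this ⊢
      linarith
    exact_mod_cast Nat.lt_succ_iff.1 hlt
  unfold tyAngle
  generalize 2 * π / (2 * k : ℕ) = α at *
  generalize ⌈((2 * k : ℕ) : ℝ) / 8⌉₊ = N at *
  refine ⟨hpos, by nlinarith [Real.pi_lt_d4], ⟨k, half_turn⟩, ⟨N, rfl⟩, ?_, ?_⟩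
  · linarith [mul_le_mul_of_nonneg_right ceil_ge hpos.le]
  · linarith [mul_le_mul_of_nonneg_right ceil_le hpos.le]

end YaoYao

end

open YaoYao in
theorem mainTheorem2_general {k : ℕ} (hk : 42 ≤ k) {P : Finset ℂ} {Y E : ℂ → ℂ → Prop}
    (hY : IsYaoGraph (2 * k) P Y) (hE : IsYaoYaoGraph (2 * k) P Y E) {t : ℝ}
    (ht : 1 + 5000 * (k : ℝ)⁻¹ ≤ t) :
    (∀ u v : ℂ, TYEdge (2 * k) P u v →
      graphDist (SimpleGraph.fromRel E) u v ≤ ENNReal.ofReal (t * dist u v)) ∧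
    ∀ u v : ℂ, graphDist (SimpleGraph.fromRel E) u v ≤
      ENNReal.ofReal t * graphDist (SimpleGraph.fromRel (TYEdge (2 * k) P)) u v := by
  have S := coneAngles_of_le hk
  have hG := hasYaoYaoSteps_of_isYaoYaoGraph (by lia) hY hE
  have hwalk (u v : ℂ) (h : TYEdge (2 * k) P u v) :
      WalkWithin (SimpleGraph.fromRel E) u v (t * dist u v) := by
    have hα := S.pos
    have hα' := S.le
    have hαk : 2 * Real.pi / (2 * k : ℕ) ≤ 3.1416 * (k : ℝ)⁻¹ := by
      push_cast
      rw [mul_div_mul_left _ _ two_ne_zero, div_eq_mul_inv]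
      gcongr
      exact Real.pi_lt_d4.le
    refine (walkWithin_of_tyEdge S (A := 1 + 1200 * (2 * Real.pi / (2 * k : ℕ)))
      (by positivity) (by nlinarith) hG h).mono ?_
    gcongr
    nlinarith
  refine ⟨fun u v h => (hwalk u v h).graphDist_le,
    graphDist_le_mul_of_forall_adj (lt_of_lt_of_le (by positivity) ht) fun p q hpq => ?_⟩
  rcases ((SimpleGraph.fromRel_adj _ _ _).1 hpq).2 with h | h
  · exact hwalk p q h
  · rw [dist_comm]
    exact (hwalk q p h).symm

theorem mainTheorem2 :
    ∃ τ' : ℕ → ℝ,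
      (fun k : ℕ => τ' k - Real.sqrt 2) =O[Filter.atTop] (fun k : ℕ => (k : ℝ)⁻¹) ∧
      ∀ k : ℕ, 42 ≤ k → ∀ (P : Finset ℂ) (Y E : ℂ → ℂ → Prop),
        YaoYao.IsYaoGraph (2 * k) P Y → YaoYao.IsYaoYaoGraph (2 * k) P Y E →
          (∀ u v : ℂ, YaoYao.TYEdge (2 * k) P u v →
            YaoYao.graphDist (SimpleGraph.fromRel E) u v ≤ ENNReal.ofReal (τ' k * dist u v)) ∧
          (∀ u ∈ P, ∀ v ∈ P,
            YaoYao.graphDist (SimpleGraph.fromRel E) u v ≤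
              ENNReal.ofReal (τ' k) *
                YaoYao.graphDist (SimpleGraph.fromRel (YaoYao.TYEdge (2 * k) P)) u v) := by
  refine ⟨fun k => √2 + 5000 * (k : ℝ)⁻¹, ?_, fun k hk P Y E hY hE => ?_⟩
  · simpa using Asymptotics.isBigO_const_mul_self (5000 : ℝ) _ _
  obtain ⟨hedge, hdist⟩ := mainTheorem2_general hk hY hE
    (add_le_add_left (Real.one_le_sqrt.2 one_le_two) (5000 * (k : ℝ)⁻¹))
  exact ⟨hedge, fun u _ v _ => hdist u v⟩
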